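/- Let $T^1,\dots,T^8$ be Hermitian traceless $3\times 3$ matrices with $\mathrm{tr}(T^AT^B)=\tfrac12\delta_{AB}$ (generators of $SU(3)$), with structure constants $f_{ABC}$ given by $[T^A,T^B]=i\sum_C f_{ABC}T^C$. Let $a_A,a_A^\dagger$ ($A=1,\dots,8$) be bosonic annihilation and creation operators, acting on the Fock states $p(a^\dagger)|0\rangle$ ($p$ a complex polynomial in eight variables), put $\phi_A=\frac{1}{\sqrt2}(a_A+a_A^\dagger)$, $\pi_A=\frac{1}{i\sqrt2}(a_A-a_A^\dagger)$, let $a=\sum_A a_AT^A$, $a^\dagger=\sum_A a_A^\dagger T^A$ be operator-valued matrices, and let $$H=\mathrm{tr}(a^\dagger a)+2-\tfrac12\mathrm{tr}(a^\dagger a^\dagger)-\tfrac12\mathrm{tr}(aa).$$ Let $N\ge 0$ be an integer (the cut-off $N_{cut}$), and let $\mathcal H_N$ be the cut bosonic ($n_F=0$) sector: the space of gauge-invariant Fock states, i.e. those with $\sum_{B,C}f_{ABC}\phi_B\pi_C|\psi\rangle=0$ for all $A$, with at most $N$ quanta. Let $P_N$ be the orthogonal projection onto the states with at most $N$ quanta.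 A solution at cut-off $N$ with energy $E\in\mathbb C$ is a nonzero $|\psi\rangle\in\mathcal H_N$ with $P_NH|\psi\rangle=E|\psi\rangle$. Write $|j,k\rangle=\mathrm{tr}(a^\dagger a^\dagger)^j\,\mathrm{tr}(a^\dagger a^\dagger a^\dagger)^k|0\rangle$. Let $L_n^\alpha(x)=\mathcal L_n^\alpha(x)/\Gamma(n+\alpha+1)$, where $\mathcal L_n^\alpha(x)=\sum_{i=0}^n(-1)^i\binom{n+\alpha}{n-i}\frac{x^i}{i!}$ is the generalized Laguerre polynomial. For $0\le t\le\kappa$ put $$\Gamma^{even}_{\kappa-1,t}=(-24)^{t-\kappa}\frac{(\kappa+t)!}{(\kappa-t)!\,(2t)!},\qquad \Gamma^{odd}_{\kappa-1,t}=(-24)^{t-\kappa}\frac{(\kappa+t+1)!}{(\kappa-t)!\,(2t+1)!},$$ $$\overline{|n,2\kappa\rangle}=|n,2\kappa\rangle+\sum_{t=1}^{\kappa}\Gamma^{even}_{\kappa-1,\kappa-t}|n+3t,2\kappa-2t\rangle,\qquad \overline{|n,2\kappa+1\rangle}=|n,2\kappa+1\rangle+\sum_{t=1}^{\kappa}\Gamma^{odd}_{\kappa-1,\kappa-t}|n+3t,2\kappa-2t+1\rangle.$$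 Then the states $|j,k\rangle$ with $2j+3k\le N$ form a basis of $\mathcal H_N$, and the following holds. 1. (Families $f_\kappa$.) Let $\kappa\ge0$, $6\kappa\le N$, and $d_\kappa=\lfloor (N-6\kappa)/2\rfloor+1$. The equation $L^{6\kappa+3}_{d_\kappa}(2E)=0$ has exactly $d_\kappa$ distinct real roots $E$, all positive, and for each of them $$|E,\kappa\rangle_{even}=(2E)^{3\kappa}e^{-E}\sum_{n=0}^{d_\kappa-1}L_n^{6\kappa+3}(2E)\,\overline{|n,2\kappa\rangle}$$ is a solution at cut-off $N$ with energy $E$. It belongs to the family $f_\kappa$: the numbers $k$ for which some $|j,k\rangle$ occurs in it with nonzero coefficient are exactly the even $k\le2\kappa$. 2. (Families $g_\kappa$.) Let $\kappa\ge0$, $6\kappa+3\le N$, and $d'_\kappa=\lfloor (N-6\kappa-3)/2\rfloor+1$. The equation $L^{6\kappa+6}_{d'_\kappa}(2E)=0$ has exactly $d'_\kappa$ distinct real roots $E$, all positive, and for each of them $$|E,\kappa\rangle_{odd}=(2E)^{3\kappa+\frac32}e^{-E}\sum_{n=0}^{d'_\kappa-1}L_n^{6\kappa+6}(2E)\,\overline{|n,2\kappa+1\rangle}$$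 is a solution at cut-off $N$ with energy $E$. It belongs to the family $g_\kappa$: the numbers $k$ for which some $|j,k\rangle$ occurs in it with nonzero coefficient are exactly the odd $k\le2\kappa+1$. 3. (Completeness.) The solutions in 1 and 2, for all admissible $\kappa$, together form a basis of $\mathcal H_N$. For every $E\in\mathbb C$, the space of all $|\psi\rangle\in\mathcal H_N$ with $P_NH|\psi\rangle=E|\psi\rangle$ is spanned by those solutions in 1 and 2 that have energy $E$. 4. (Spectrum.) Let $$\Theta^{n_F=0}_{N}(E)=\prod_{k=0}^{\lfloor N/3\rfloor}L^{3k+3}_{\lfloor (N-3k)/2\rfloor+1}(2E).$$ Then $\Theta^{n_F=0}_N(E)=\prod_{\kappa\ge0,\,6\kappa\le N}L^{6\kappa+3}_{d_\kappa}(2E)\cdot\prod_{\kappa\ge0,\,6\kappa+3\le N}L^{6\kappa+6}_{d'_\kappa}(2E)$, and a number $E\in\mathbb C$ is the energy of a solution at cut-off $N$ if and only if $\Theta^{n_F=0}_N(E)=0$. -/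

import Mathlib

noncomputable section

open Polynomial in
/-- The generalized Laguerre polynomial `𝓛_n^α(x) = ∑_{i=0}^n (-1)^i (n+α choose n-i) x^i / i!`
for an integer parameter `α ≥ 0`. -/
def laguerre (n α : ℕ) : ℝ[X] :=
  ∑ i ∈ Finset.range (n + 1),
    C ((-1 : ℝ) ^ i * ((n + α).choose (n - i) : ℝ) / (i.factorial : ℝ)) * X ^ i

open Polynomial in
/-- The rescaled Laguerre (Sonine) polynomial `L_n^α = 𝓛_n^α / Γ(n+α+1)`. -/
def sonine (n α : ℕ) : ℝ[X] :=
  C (Real.Gamma ((n : ℝ) + α + 1))⁻¹ * laguerre n α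

/-- `T` is a system of generators of `SU(3)` in the fundamental representation with the usual
normalization: Hermitian, traceless, `tr (T^A T^B) = δ_{AB} / 2`. -/
def IsSU3Generators (T : Fin 8 → Matrix (Fin 3) (Fin 3) ℂ) : Prop :=
  (∀ A, (T A).IsHermitian) ∧ (∀ A, (T A).trace = 0) ∧
    ∀ A B, (T A * T B).trace = if A = B then 1 / 2 else 0

/-- Structure constants `f_{ABC}`, determined by `[T^A, T^B] = i f_{ABC} T^C`. -/
def structureConst (T : Fin 8 → Matrix (Fin 3) (Fin 3) ℂ) (A B C : Fin 8) : ℂ :=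
  -2 * Complex.I * ((T A * T B - T B * T A) * T C).trace

/-- Fock states with finitely many quanta of the eight bosonic oscillators and no fermion
(`n_F = 0`): the polynomial `p` stands for the state `p(a†)|0⟩`, where `|0⟩` is the vacuum `1`. -/
abbrev Fock : Type := MvPolynomial (Fin 8) ℂ

/-- The creation operator `a†_A`. -/
def creation (A : Fin 8) : Module.End ℂ Fock :=
  LinearMap.mulLeft ℂ (MvPolynomial.X A : Fock)

/-- The annihilation operator `a_A`. -/
def annihilation (A : Fin 8) : Module.End ℂ Fock :=
  (MvPolynomial.pderiv A : Derivation ℂ Fock Fock).toLinearMap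

/-- The field operator `φ_A = (a_A + a†_A) / √2`. -/
def fieldOp (A : Fin 8) : Module.End ℂ Fock :=
  ((Real.sqrt 2 : ℝ) : ℂ)⁻¹ • (annihilation A + creation A)

/-- The momentum operator `π_A = (a_A - a†_A) / (i √2)`. -/
def momentumOp (A : Fin 8) : Module.End ℂ Fock :=
  (Complex.I * ((Real.sqrt 2 : ℝ) : ℂ))⁻¹ • (annihilation A - creation A)

/-- The gauge generator `G_A = f_{ABC} φ_B π_C`. Its fermionic part
`-i f_{ABC} λ̄_B λ_C` vanishes on states without fermions. -/
def gaugeGenerator (T : Fin 8 → Matrix (Fin 3) (Fin 3) ℂ) (A : Fin 8) : Module.End ℂ Fock :=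
  ∑ B, ∑ C, structureConst T A B C • (fieldOp B * momentumOp C)

/-- The operator-valued matrix `a†_{ij} = a†_A T^A_{ij}`. -/
def creationMatrix (T : Fin 8 → Matrix (Fin 3) (Fin 3) ℂ) :
    Matrix (Fin 3) (Fin 3) (Module.End ℂ Fock) :=
  Matrix.of fun i j => ∑ A, T A i j • creation A

/-- The operator-valued matrix `a_{ij} = a_A T^A_{ij}`. -/
def annihilationMatrix (T : Fin 8 → Matrix (Fin 3) (Fin 3) ℂ) :
    Matrix (Fin 3) (Fin 3) (Module.End ℂ Fock) :=
  Matrix.of fun i j => ∑ A, T A i j • annihilation A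

/-- The Hamiltonian `H = tr(a†a) + 2 - tr(a†a†)/2 - tr(aa)/2`. -/
def hamiltonian (T : Fin 8 → Matrix (Fin 3) (Fin 3) ℂ) : Module.End ℂ Fock :=
  (creationMatrix T * annihilationMatrix T).trace + (2 : ℂ) • (1 : Module.End ℂ Fock)
    - (1 / 2 : ℂ) • (creationMatrix T * creationMatrix T).trace
    - (1 / 2 : ℂ) • (annihilationMatrix T * annihilationMatrix T).trace

/-- The physical states of the bosonic sector with at most `N` quanta: the solutions of the
Gauss law `G_A |ψ⟩ = 0` whose polynomial has total degree at most `N`. -/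
def cutSpace (T : Fin 8 → Matrix (Fin 3) (Fin 3) ℂ) (N : ℕ) : Submodule ℂ Fock :=
  (⨅ A, LinearMap.ker (gaugeGenerator T A)) ⊓ MvPolynomial.restrictTotalDegree (Fin 8) ℂ N

/-- The orthogonal projection onto the states with at most `N` quanta (states with different
numbers of quanta are orthogonal). -/
def cutProjection (N : ℕ) : Module.End ℂ Fock :=
  ∑ n ∈ Finset.range (N + 1), MvPolynomial.homogeneousComponent n

/-- The solutions `|E⟩`, zero included, of the eigenvalue problem `P_N H |E⟩ = E |E⟩` of the
cut Hamiltonian in the space of physical states with at most `N` quanta. -/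
def cutEigenspace (T : Fin 8 → Matrix (Fin 3) (Fin 3) ℂ) (N : ℕ) (E : ℂ) : Submodule ℂ Fock :=
  cutSpace T N ⊓
    LinearMap.ker (cutProjection N * hamiltonian T - E • (1 : Module.End ℂ Fock))

/-- The Fock state `|j, k⟩ = (a†a†)^j (a†a†a†)^k |0⟩`. -/
def brickState (T : Fin 8 → Matrix (Fin 3) (Fin 3) ℂ) (j k : ℕ) : Fock :=
  ((creationMatrix T * creationMatrix T).trace ^ j *
    (creationMatrix T * creationMatrix T * creationMatrix T).trace ^ k) (1 : Fock)

/-- `Γ^even_{κ-1,t}`, for `t ≤ κ`. -/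
def gammaEven (κ t : ℕ) : ℂ :=
  (-24 : ℂ) ^ ((t : ℤ) - (κ : ℤ)) *
    (((κ + t).factorial : ℂ) / (((κ - t).factorial : ℂ) * ((2 * t).factorial : ℂ)))

/-- `Γ^odd_{κ-1,t}`, for `t ≤ κ`. -/
def gammaOdd (κ t : ℕ) : ℂ :=
  (-24 : ℂ) ^ ((t : ℤ) - (κ : ℤ)) *
    (((κ + t + 1).factorial : ℂ) / (((κ - t).factorial : ℂ) * ((2 * t + 1).factorial : ℂ)))

/-- The mixed Fock state `|n, 2κ⟩` with an overline. -/
def mixedEven (T : Fin 8 → Matrix (Fin 3) (Fin 3) ℂ) (n κ : ℕ) : Fock :=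
  brickState T n (2 * κ) +
    ∑ t ∈ Finset.Icc 1 κ, gammaEven κ (κ - t) • brickState T (n + 3 * t) (2 * κ - 2 * t)

/-- The mixed Fock state `|n, 2κ+1⟩` with an overline. -/
def mixedOdd (T : Fin 8 → Matrix (Fin 3) (Fin 3) ℂ) (n κ : ℕ) : Fock :=
  brickState T n (2 * κ + 1) +
    ∑ t ∈ Finset.Icc 1 κ, gammaOdd κ (κ - t) • brickState T (n + 3 * t) (2 * κ - 2 * t + 1)

/-- `d_κ(N) = ⌊(N - 6κ)/2⌋ + 1`, for `6κ ≤ N`. -/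
def dEven (N κ : ℕ) : ℕ := (N - 6 * κ) / 2 + 1

/-- `d'_κ(N) = ⌊(N - 6κ - 3)/2⌋ + 1`, for `6κ + 3 ≤ N`. -/
def dOdd (N κ : ℕ) : ℕ := (N - 6 * κ - 3) / 2 + 1

/-- The state `|E, κ⟩_even` at cut-off `N`. -/
def evenState (T : Fin 8 → Matrix (Fin 3) (Fin 3) ℂ) (N κ : ℕ) (E : ℝ) : Fock :=
  (((2 * E) ^ (3 * κ) * Real.exp (-E) : ℝ) : ℂ) •
    ∑ n ∈ Finset.range (dEven N κ),
      (((sonine n (6 * κ + 3)).eval (2 * E) : ℝ) : ℂ) • mixedEven T n κ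

/-- The state `|E, κ⟩_odd` at cut-off `N`. -/
def oddState (T : Fin 8 → Matrix (Fin 3) (Fin 3) ℂ) (N κ : ℕ) (E : ℝ) : Fock :=
  (((2 * E) ^ (3 * (κ : ℝ) + 3 / 2) * Real.exp (-E) : ℝ) : ℂ) •
    ∑ n ∈ Finset.range (dOdd N κ),
      (((sonine n (6 * κ + 6)).eval (2 * E) : ℝ) : ℂ) • mixedOdd T n κ

/-- The energies of the family `f_κ` at cut-off `N`. -/
def evenEnergies (N κ : ℕ) : Set ℝ :=
  {E | (sonine (dEven N κ) (6 * κ + 3)).eval (2 * E) = 0}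

/-- The energies of the family `g_κ` at cut-off `N`. -/
def oddEnergies (N κ : ℕ) : Set ℝ :=
  {E | (sonine (dOdd N κ) (6 * κ + 6)).eval (2 * E) = 0}

/-- Labels `(κ, E)` of the solutions in the families `f_κ` present at cut-off `N`. -/
def EvenLabel (N : ℕ) : Type :=
  {p : ℕ × ℝ // 6 * p.1 ≤ N ∧ p.2 ∈ evenEnergies N p.1}

/-- Labels `(κ, E)` of the solutions in the families `g_κ` present at cut-off `N`. -/
def OddLabel (N : ℕ) : Type :=
  {p : ℕ × ℝ // 6 * p.1 + 3 ≤ N ∧ p.2 ∈ oddEnergies N p.1}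

/-- All the solutions at cut-off `N`, by label. -/
def solution (T : Fin 8 → Matrix (Fin 3) (Fin 3) ℂ) (N : ℕ) : EvenLabel N ⊕ OddLabel N → Fock :=
  Sum.elim (fun p => evenState T N p.1.1 p.1.2) (fun p => oddState T N p.1.1 p.1.2)

/-- The energy of a label. -/
def energy (N : ℕ) : EvenLabel N ⊕ OddLabel N → ℝ :=
  Sum.elim (fun p => p.1.2) (fun p => p.1.2)

/-- The pairs `(j, k)` with `2j + 3k ≤ N`. -/
def brickIndices (N : ℕ) : Finset (ℕ × ℕ) :=
  (Finset.range (N + 1) ×ˢ Finset.range (N + 1)).filter fun p => 2 * p.1 + 3 * p.2 ≤ N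

/-- `ψ = ∑_{2j+3k ≤ N} a_{j,k} |j, k⟩`, where the indices `k` with some `a_{j,k} ≠ 0` are exactly
those `k ≤ K` that have the parity of `K`. The family `f_κ` is the case `K = 2κ`, and the
family `g_κ` is the case `K = 2κ + 1`. -/
def InFamily (T : Fin 8 → Matrix (Fin 3) (Fin 3) ℂ) (N K : ℕ) (ψ : Fock) : Prop :=
  ∃ a : ℕ × ℕ → ℂ, ψ = ∑ p ∈ brickIndices N, a p • brickState T p.1 p.2 ∧
    ∀ k, (∃ j, (j, k) ∈ brickIndices N ∧ a (j, k) ≠ 0) ↔ k ≤ K ∧ k % 2 = K % 2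

open Polynomial in
/-- `Θ_N(E) = ∏_{k=0}^{⌊N/3⌋} L^{3k+3}_{⌊(N-3k)/2⌋+1}(2E)`, as a polynomial in `E`. -/
def thetaPoly (N : ℕ) : ℝ[X] :=
  ∏ k ∈ Finset.range (N / 3 + 1), (sonine ((N - 3 * k) / 2 + 1) (3 * k + 3)).comp (C 2 * X)

end

/-! Evaluating a Fock state at the coordinates of a traceless matrix `Y` turns it into a polynomial
function on the traceless 3×3 complex matrices. There the gauge generator is, up to sign,
differentiation along `[T A, Y]`, so the Gauss law says that the function is invariant under
conjugation (`eval_conj`). A generic `Y` is conjugate to the companion matrix of its characteristic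
polynomial, so an invariant is a polynomial in q = tr Y² and c = tr Y³
(`extendSlice_restrictSlice`). On companion matrices q and c are independent coordinates, which
makes the products q^j c^k, the states |j,k⟩, a basis.

On polynomials of degree m the Hamiltonian is m/2 + 2 − q/2 − Δ/4 (`hamiltonian_apply`). The
commutator of Δ with q is 8 + 2m, the usual sl₂ relation. For each K there is a harmonic polynomial
h_K in q and c with leading term c^K (`laplacian_harmonic`), and on the states q^n h_K the
Hamiltonian is tridiagonal in n (`hamiltonian_sectorState`). The overlined states are exactly these,
with K = 2κ or K = 2κ + 1. For fixed K the coefficients L_n^{3K+3}(2E) solve the eigenvalue equation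
by their three-term recurrence, except for two boundary terms: one is removed by the cut-off
projection, the other vanishes at the chosen energies (`sum_hamiltonian_sectorState`).

Completeness is a count. By Christoffel–Darboux the Sonine polynomials have only real simple roots
(`ncard_sonine_roots`), so sector K supplies as many energies as it has states. Within a sector the
energies are distinct, and different sectors are linearly independent; hence the solutions form a
basis (`span_solution`). A basis of eigenvectors determines every eigenspace, and Θ is the product
of the quantization conditions over all K. -/

namespace SU3Fock

open MvPolynomial

/-! ### Coordinates on traceless matrices -/

section Completeness

variable {T : Fin 8 → Matrix (Fin 3) (Fin 3) ℂ}

/-- The coordinates of the traceless part of a matrix with respect to the generators. -/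
noncomputable def coord (T : Fin 8 → Matrix (Fin 3) (Fin 3) ℂ) (Y : Matrix (Fin 3) (Fin 3) ℂ)
    (A : Fin 8) : ℂ :=
  2 * (T A * Y).trace

/-- The matrix with given coordinates. -/
noncomputable def matrixOf (T : Fin 8 → Matrix (Fin 3) (Fin 3) ℂ) (x : Fin 8 → ℂ) :
    Matrix (Fin 3) (Fin 3) ℂ :=
  ∑ A, x A • T A

theorem trace_matrixOf (hT : IsSU3Generators T) (x : Fin 8 → ℂ) : (matrixOf T x).trace = 0 := by
  simp [matrixOf, Matrix.trace_sum, hT.2.1]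

theorem coord_matrixOf (hT : IsSU3Generators T) (x : Fin 8 → ℂ) : coord T (matrixOf T x) = x := by
  funext A
  simp [coord, matrixOf, Finset.mul_sum, Matrix.trace_sum, hT.2.2]
  ring

theorem coord_one (hT : IsSU3Generators T) (A : Fin 8) : coord T 1 A = 0 := by
  simp [coord, hT.2.1]

theorem coord_add (Y Z : Matrix (Fin 3) (Fin 3) ℂ) (A : Fin 8) :
    coord T (Y + Z) A = coord T Y A + coord T Z A := by
  simp [coord, mul_add]

theorem coord_smul (s : ℂ) (Y : Matrix (Fin 3) (Fin 3) ℂ) (A : Fin 8) :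
    coord T (s • Y) A = s * coord T Y A := by
  simp [coord]; ring

/-- The generators together with the identity span all matrices. -/
theorem matrixOf_coord_add (hT : IsSU3Generators T) (Y : Matrix (Fin 3) (Fin 3) ℂ) :
    matrixOf T (coord T Y) + (Y.trace / 3) • (1 : Matrix (Fin 3) (Fin 3) ℂ) = Y := by
  let Φ : Matrix (Fin 3) (Fin 3) ℂ →ₗ[ℂ] (Option (Fin 8) → ℂ) :=
    { toFun := fun Y o => o.elim Y.trace (coord T Y)
      map_add' := by
        intro Y Z; funext o; cases o <;> simp [coord_add]
      map_smul' := by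
        intro s Y; funext o; cases o <;> simp [coord_smul] }
  have hΦ : ∀ v : Option (Fin 8) → ℂ, Φ (matrixOf T (fun A => v (some A)) +
      (v none / 3) • (1 : Matrix (Fin 3) (Fin 3) ℂ)) = v := by
    intro v
    funext o
    cases o with
    | none => simp [Φ, trace_matrixOf hT]
    | some A => simp [Φ, coord_add, coord_smul, coord_one hT, coord_matrixOf hT]
  have hinj : Function.Injective Φ := by
    -- Both spaces have dimension 9, so the right inverse found in `hΦ` already makes `Φ` injective.
    refine (LinearMap.injective_iff_surjective_of_finrank_eq_finrank ?_).2 fun v => ⟨_, hΦ v⟩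
    simp [Module.finrank_matrix]
  exact hinj (hΦ (Φ Y))

theorem matrixOf_coord (hT : IsSU3Generators T) {Y : Matrix (Fin 3) (Fin 3) ℂ}
    (hY : Y.trace = 0) : matrixOf T (coord T Y) = Y := by
  simpa [hY] using matrixOf_coord_add hT Y

/-- The Fierz identity. -/
theorem sum_generators_mul (hT : IsSU3Generators T) (i j k l : Fin 3) :
    ∑ A, T A i j * T A k l =
      (1 / 2) * ((if i = l then 1 else 0) * (if j = k then 1 else 0) -
        (1 / 3) * ((if i = j then 1 else 0) * (if k = l then 1 else 0))) := by
  -- Expanding the matrix unit at `(l, k)` isolates the single entry `T A k l` as its coordinate.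
  have h := congrFun (congrFun (matrixOf_coord_add hT (Matrix.single l k 1)) i) j
  simp only [matrixOf, coord, Matrix.trace_mul_single, Matrix.add_apply, Matrix.sum_apply, Matrix.smul_apply,
    smul_eq_mul, Matrix.one_apply,
    Matrix.single_apply] at h
  have h2 : (Matrix.single l k (1 : ℂ)).trace = if k = l then 1 else 0 := by
    by_cases hkl : k = l
    · subst hkl; simp
    · rw [Matrix.trace_single_eq_of_ne _ _ _ (Ne.symm hkl)]; simp [hkl]
  rw [h2] at h
  have h3 : ∑ A, T A i j * T A k l = (1 / 2) * ∑ A, 2 * (T A k l * 1) * T A i j := by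
    rw [Finset.mul_sum]; exact Finset.sum_congr rfl fun A _ => by ring
  simp only [MulOpposite.op_one, one_smul] at h
  rw [h3]
  have h4 : (if l = i ∧ k = j then (1 : ℂ) else 0) =
      (if i = l then 1 else 0) * (if j = k then 1 else 0) := by
    by_cases h5 : i = l <;> by_cases h6 : j = k <;> simp [h5, h6, eq_comm]
  rw [h4] at h
  simp only [mul_one] at h ⊢
  rw [← h]; ring

end Completeness

/-! ### Gauge invariance as invariance under conjugation -/

section Gauge

variable {T : Fin 8 → Matrix (Fin 3) (Fin 3) ℂ}

theorem structureConst_antisymm (A B C : Fin 8) :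
    structureConst T A C B = -structureConst T A B C := by
  have h1 : (T A * T C * T B).trace = (T B * T A * T C).trace := by
    rw [Matrix.trace_mul_comm, Matrix.mul_assoc]
  have h2 : (T C * T A * T B).trace = (T A * T B * T C).trace := by
    rw [Matrix.mul_assoc, Matrix.trace_mul_comm]
  simp only [structureConst, Matrix.sub_mul, Matrix.trace_sub, h1, h2]
  ring

theorem pderiv_pderiv_comm {σ R : Type*} [CommRing R] (p : MvPolynomial σ R) (i j : σ) :
    pderiv i (pderiv j p) = pderiv j (pderiv i p) := by
  classical
  have h : ⁅(pderiv i : Derivation R (MvPolynomial σ R) (MvPolynomial σ R)),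
      (pderiv j : Derivation R (MvPolynomial σ R) (MvPolynomial σ R))⁆ = 0 := by
    refine MvPolynomial.derivation_ext fun k => ?_
    rw [Derivation.commutator_apply, pderiv_X, pderiv_X]
    simp only [Pi.single_apply]
    split_ifs <;> simp
  have h2 := congrArg (fun d => d p) h
  simpa [Derivation.commutator_apply, sub_eq_zero] using h2

/-- The terms in `a a`, in `a† a†` and from normal ordering are symmetric in `B, C` and die against
the antisymmetric structure constants. The two mixed terms agree, leaving a first-order differential
operator. -/
theorem gaugeGenerator_apply (A : Fin 8) (p : Fock) :
    gaugeGenerator T A p =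
      (-Complex.I) • ∑ B, ∑ C, structureConst T A B C • (X B * pderiv C p) := by
  have hs : ((Real.sqrt 2 : ℝ) : ℂ)⁻¹ * (Complex.I * ((Real.sqrt 2 : ℝ) : ℂ))⁻¹ =
      -Complex.I / 2 := by
    have h2 : ((Real.sqrt 2 : ℝ) : ℂ) ^ 2 = 2 := by
      rw [← Complex.ofReal_pow, Real.sq_sqrt (by norm_num)]; simp
    have h0 : ((Real.sqrt 2 : ℝ) : ℂ) ≠ 0 := by
      intro h; rw [h] at h2; norm_num at h2
    rw [mul_inv, Complex.inv_I]
    field_simp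
    rw [h2]
  have hterm : ∀ B C : Fin 8, (fieldOp B * momentumOp C) p = (-Complex.I / 2) •
      (pderiv B (pderiv C p) - (if B = C then p else 0) - X C * pderiv B p
        + X B * pderiv C p - X B * X C * p) := by
    intro B C
    simp only [fieldOp, momentumOp, smul_mul_smul_comm, hs, LinearMap.smul_apply,
      Module.End.mul_apply, LinearMap.add_apply, LinearMap.sub_apply, annihilation, creation,
      LinearMap.mulLeft_apply, Derivation.coeFn_coe, map_sub, Derivation.leibniz, pderiv_X,
      smul_eq_mul, Pi.single_apply]
    congr 1
    by_cases h : B = C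
    · subst h; simp; ring
    · simp [h, Ne.symm h]; ring
  have hanti : ∀ F : Fin 8 → Fin 8 → Fock, (∀ B C, F C B = F B C) →
      ∑ B, ∑ C, structureConst T A B C • F B C = 0 := by
    intro F hF
    have h : ∑ B, ∑ C, structureConst T A B C • F B C =
        -∑ B, ∑ C, structureConst T A B C • F B C := by
      conv_lhs => rw [Finset.sum_comm]
      rw [← Finset.sum_neg_distrib]
      refine Finset.sum_congr rfl fun B _ => ?_
      rw [← Finset.sum_neg_distrib]
      refine Finset.sum_congr rfl fun C _ => ?_
      rw [structureConst_antisymm, hF, neg_smul]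
    exact self_eq_neg.1 h
  have hswap : ∑ B, ∑ C, structureConst T A B C • (X C * pderiv B p) =
      -∑ B, ∑ C, structureConst T A B C • (X B * pderiv C p) := by
    rw [Finset.sum_comm, ← Finset.sum_neg_distrib]
    refine Finset.sum_congr rfl fun B _ => ?_
    rw [← Finset.sum_neg_distrib]
    refine Finset.sum_congr rfl fun C _ => ?_
    rw [structureConst_antisymm, neg_smul]
  have h1 := hanti (fun B C => pderiv B (pderiv C p)) fun B C => by
    exact pderiv_pderiv_comm p C B
  have h2 := hanti (fun B C => if B = C then p else 0) fun B C => by simp [eq_comm]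
  have h3 := hanti (fun B C => X B * X C * p) fun B C => by ring
  simp only [gaugeGenerator, LinearMap.sum_apply, LinearMap.smul_apply, hterm]
  simp only [smul_comm (structureConst T A _ _) (-Complex.I / 2), ← Finset.smul_sum, smul_sub,
    smul_add, Finset.sum_sub_distrib, Finset.sum_add_distrib, h1, h2, h3, hswap]
  module

/-- Identifies the vector field of the gauge generator with the adjoint action of `T A`. -/
theorem coord_commutator (A : Fin 8) (x : Fin 8 → ℂ) (C : Fin 8) :
    coord T (T A * matrixOf T x - matrixOf T x * T A) C =
      Complex.I * ∑ B, structureConst T A B C * x B := by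
  simp only [coord, matrixOf, Finset.mul_sum, Finset.sum_mul, ← Finset.sum_sub_distrib,
    Matrix.trace_sum, structureConst]
  refine Finset.sum_congr rfl fun B _ => ?_
  have : (T C * (T A * x B • T B - x B • T B * T A)).trace =
      x B * ((T A * T B - T B * T A) * T C).trace := by
    rw [Matrix.trace_mul_comm, Matrix.mul_smul, Matrix.smul_mul, ← smul_sub, Matrix.smul_mul,
      Matrix.trace_smul, smul_eq_mul]
  rw [this]
  linear_combination (2 * x B * ((T A * T B - T B * T A) * T C).trace) * Complex.I_sq

/-- The differential of a polynomial at `Y` in the direction `W`. -/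
noncomputable def dirDeriv (T : Fin 8 → Matrix (Fin 3) (Fin 3) ℂ) (p : Fock)
    (Y W : Matrix (Fin 3) (Fin 3) ℂ) : ℂ :=
  ∑ C, coord T W C * eval (coord T Y) (pderiv C p)

theorem dirDeriv_add (p : Fock) (Y W W' : Matrix (Fin 3) (Fin 3) ℂ) :
    dirDeriv T p Y (W + W') = dirDeriv T p Y W + dirDeriv T p Y W' := by
  simp [dirDeriv, coord_add, add_mul, Finset.sum_add_distrib]

theorem dirDeriv_smul (p : Fock) (Y W : Matrix (Fin 3) (Fin 3) ℂ) (s : ℂ) :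
    dirDeriv T p Y (s • W) = s * dirDeriv T p Y W := by
  simp [dirDeriv, coord_smul, Finset.mul_sum, mul_assoc]

theorem gaugeGenerator_eval (hT : IsSU3Generators T) (A : Fin 8) (p : Fock)
    (Y : Matrix (Fin 3) (Fin 3) ℂ) :
    eval (coord T Y) (gaugeGenerator T A p) = -dirDeriv T p Y (T A * Y - Y * T A) := by
  have hY : T A * Y - Y * T A =
      T A * matrixOf T (coord T Y) - matrixOf T (coord T Y) * T A := by
    conv_lhs => rw [← matrixOf_coord_add hT Y]
    simp [Matrix.mul_add, Matrix.add_mul]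
  rw [gaugeGenerator_apply, dirDeriv, hY, Finset.sum_comm]
  simp only [coord_commutator, smul_eval, map_sum, map_mul, eval_X, Finset.mul_sum, Finset.sum_mul,
    ← Finset.sum_neg_distrib]
  refine Finset.sum_congr rfl fun C _ => Finset.sum_congr rfl fun B _ => ?_
  ring

/-- The differential is complex linear in its direction, so invariance under the eight Hermitian
generators extends to every complex `Z`. This passage from SU(3) to its complexification is what
permits conjugation by arbitrary invertible matrices. -/
theorem dirDeriv_commutator_eq_zero (hT : IsSU3Generators T) {p : Fock}
    (hp : ∀ A, gaugeGenerator T A p = 0) (Y Z : Matrix (Fin 3) (Fin 3) ℂ) :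
    dirDeriv T p Y (Z * Y - Y * Z) = 0 := by
  have hA : ∀ A, dirDeriv T p Y (T A * Y - Y * T A) = 0 := fun A => by
    have := gaugeGenerator_eval hT A p Y
    rw [hp A] at this
    simpa using this.symm
  have hsum : ∀ s : Finset (Fin 8), ∀ x : Fin 8 → ℂ,
      dirDeriv T p Y (∑ A ∈ s, x A • (T A * Y - Y * T A)) = 0 := by
    intro s x
    induction s using Finset.induction_on with
    | empty => simp [dirDeriv, coord]
    | insert a s ha ih => rw [Finset.sum_insert ha, dirDeriv_add, ih, dirDeriv_smul, hA]; simp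
  have hZ : Z * Y - Y * Z = ∑ A, coord T Z A • (T A * Y - Y * T A) := by
    conv_lhs => rw [← matrixOf_coord_add hT Z]
    simp [Matrix.mul_add, Matrix.add_mul, matrixOf, Matrix.sum_mul, Matrix.mul_sum, smul_sub,
      Finset.sum_sub_distrib]
  rw [hZ, hsum]

theorem hasDerivAt_eval {σ : Type*} [Fintype σ] (p : MvPolynomial σ ℂ) {x : ℂ → σ → ℂ}
    {x' : σ → ℂ} {s : ℂ} (hx : ∀ i, HasDerivAt (fun u => x u i) (x' i) s) :
    HasDerivAt (fun u => eval (x u) p) (∑ i, x' i * eval (x s) (pderiv i p)) s := by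
  classical
  induction p using MvPolynomial.induction_on with
  | C a => simpa using hasDerivAt_const s a
  | add p q hp hq =>
    simp only [map_add, mul_add, Finset.sum_add_distrib]
    exact hp.add hq
  | mul_X p i hp =>
    have := hp.mul (hx i)
    simp only [map_mul, eval_X]
    refine this.congr_deriv ?_
    simp only [Derivation.leibniz, pderiv_X, smul_eq_mul, map_add, map_mul, eval_X, mul_add,
      Finset.sum_add_distrib, Finset.sum_mul]
    rw [add_comm]
    congr 1
    · rw [Finset.sum_eq_single i]
      · simp; ring
      · intro j _ hj; simp [Ne.symm hj]
      · simp
    · exact Finset.sum_congr rfl fun j _ => by ring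

/-- A gauge invariant polynomial is constant along the curves `γ' = [Z, γ]`. -/
theorem eval_curve_eq (hT : IsSU3Generators T) {p : Fock}
    (hp : ∀ A, gaugeGenerator T A p = 0) (Z : Matrix (Fin 3) (Fin 3) ℂ)
    (γ : ℂ → Matrix (Fin 3) (Fin 3) ℂ)
    (hγ : ∀ s i j, HasDerivAt (fun u => γ u i j) ((Z * γ s - γ s * Z) i j) s) (s t : ℂ) :
    eval (coord T (γ s)) p = eval (coord T (γ t)) p := by
  have hd : ∀ s, HasDerivAt (fun u => eval (coord T (γ u)) p) 0 s := by
    intro s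
    have hx : ∀ A, HasDerivAt (fun u => coord T (γ u) A) (coord T (Z * γ s - γ s * Z) A) s := by
      intro A
      simp only [coord, Matrix.trace, Matrix.diag, Matrix.mul_apply (M := T A)]
      refine HasDerivAt.const_mul 2 (HasDerivAt.fun_sum fun i _ => HasDerivAt.fun_sum fun j _ => ?_)
      exact (hγ s j i).const_mul _
    exact (hasDerivAt_eval p hx).congr_deriv (dirDeriv_commutator_eq_zero hT hp (γ s) Z)
  exact is_const_of_deriv_eq_zero (fun u => (hd u).differentiableAt) (fun u => (hd u).deriv) s t

/-- Since `E * E = 0`, the one-parameter group of `E` is `1 + s E`, and the curve used is `(1 + s E)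
Y (1 - s E)`, a quadratic polynomial in `s`. -/
theorem eval_conj_transvection (hT : IsSU3Generators T) {p : Fock}
    (hp : ∀ A, gaugeGenerator T A p = 0) (E Y : Matrix (Fin 3) (Fin 3) ℂ) (hE : E * E = 0) :
    eval (coord T ((1 + E) * Y * (1 - E))) p = eval (coord T Y) p := by
  have h := eval_curve_eq hT hp E
    (fun s => Y + s • (E * Y - Y * E) + s ^ 2 • (-(E * Y * E))) ?_ 1 0
  · convert h using 4
    · simp only [one_smul, one_pow]
      noncomm_ring
    · simp
  · intro s i j
    have h1 : E * (Y + s • (E * Y - Y * E) + s ^ 2 • (-(E * Y * E))) -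
        (Y + s • (E * Y - Y * E) + s ^ 2 • (-(E * Y * E))) * E =
        (E * Y - Y * E) + (2 * s) • (-(E * Y * E)) := by
      have e1 : E * (E * Y) = 0 := by rw [← mul_assoc, hE, zero_mul]
      have e2 : E * (E * (Y * E)) = 0 := by rw [← mul_assoc, hE, zero_mul]
      have e3 : Y * (E * E) = 0 := by rw [hE, mul_zero]
      simp only [mul_add, add_mul, mul_smul_comm, smul_mul_assoc, mul_sub, sub_mul, mul_assoc,
        mul_neg, neg_mul, e1, e2, hE, mul_zero]
      module
    rw [h1]
    simp only [Matrix.add_apply, Matrix.smul_apply, smul_eq_mul]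
    have h2 := (((hasDerivAt_id s).mul_const ((E * Y - Y * E) i j)).const_add (Y i j)).add
      ((hasDerivAt_pow 2 s).mul_const ((-(E * Y * E)) i j))
    refine h2.congr_deriv ?_
    simp

/-- With `z` an entrywise logarithm of `D`, the orbit of `Y` under `exp (s z)` joins `Y` at `s = 0`
to its conjugate at `s = 1`. Any branch of the logarithm serves. -/
theorem eval_conj_diagonal (hT : IsSU3Generators T) {p : Fock}
    (hp : ∀ A, gaugeGenerator T A p = 0) (D : Fin 3 → ℂ) (hD : ∀ i, D i ≠ 0)
    (Y : Matrix (Fin 3) (Fin 3) ℂ) :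
    eval (coord T (Matrix.diagonal D * Y * (Matrix.diagonal D)⁻¹)) p = eval (coord T Y) p := by
  have hz : ∀ i, Complex.exp (Complex.log (D i)) = D i := fun i => Complex.exp_log (hD i)
  set z : Fin 3 → ℂ := fun i => Complex.log (D i)
  have h := eval_curve_eq hT hp (Matrix.diagonal z)
    (fun s => Matrix.of fun i j => Complex.exp (s * (z i - z j)) * Y i j) ?_ 1 0
  · have hinv : (Matrix.diagonal D)⁻¹ = Matrix.diagonal fun i => (D i)⁻¹ := by
      refine Matrix.inv_eq_left_inv ?_
      rw [Matrix.diagonal_mul_diagonal, ← Matrix.diagonal_one]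
      congr 1
      funext i
      simp [hD i]
    have h1 : Matrix.diagonal D * Y * (Matrix.diagonal D)⁻¹ =
        Matrix.of fun i j => Complex.exp (1 * (z i - z j)) * Y i j := by
      ext i j
      rw [hinv, Matrix.mul_diagonal, Matrix.diagonal_mul, Matrix.of_apply, one_mul,
        Complex.exp_sub, hz, hz]
      ring
    have h2 : Y = Matrix.of fun i j => Complex.exp (0 * (z i - z j)) * Y i j := by
      ext i j; simp
    rw [h1, h]
    conv_rhs => rw [h2]
  · intro s i j
    rw [Matrix.sub_apply, Matrix.diagonal_mul, Matrix.mul_diagonal]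
    simp only [Matrix.of_apply]
    have h2 := (((hasDerivAt_id s).mul_const (z i - z j)).cexp).mul_const (Y i j)
    refine h2.congr_deriv ?_
    simp only [id]
    ring

/-- Gauge invariant polynomials are invariant under conjugation. -/
theorem eval_conj (hT : IsSU3Generators T) {p : Fock}
    (hp : ∀ A, gaugeGenerator T A p = 0) (g : Matrix (Fin 3) (Fin 3) ℂ) (hg : g.det ≠ 0)
    (Y : Matrix (Fin 3) (Fin 3) ℂ) :
    eval (coord T (g * Y * g⁻¹)) p = eval (coord T Y) p := by
  revert Y
  -- Invertible matrices are products of diagonal ones and transvections, and each of these lies on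
  -- an explicit one-parameter group.
  refine Matrix.diagonal_transvection_induction_of_det_ne_zero
    (fun g => ∀ Y, eval (coord T (g * Y * g⁻¹)) p = eval (coord T Y) p) g hg ?_ ?_ ?_
  · intro D hD Y
    rw [Matrix.det_diagonal] at hD
    exact eval_conj_diagonal hT hp D
      (fun i => (Finset.prod_ne_zero_iff.1 hD) i (Finset.mem_univ i)) Y
  · intro t Y
    have hsq : Matrix.single t.i t.j t.c * Matrix.single t.i t.j t.c = 0 := by
      rw [Matrix.single_mul_single_of_ne _ _ _ _ (Ne.symm t.hij)]
    have hinv : (t.toMatrix)⁻¹ = 1 - Matrix.single t.i t.j t.c := by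
      refine Matrix.inv_eq_left_inv ?_
      rw [Matrix.TransvectionStruct.toMatrix, Matrix.transvection, sub_mul, one_mul, mul_add,
        mul_one, hsq]
      simp
    rw [hinv, Matrix.TransvectionStruct.toMatrix, Matrix.transvection]
    exact eval_conj_transvection hT hp _ Y hsq
  · intro A B _ _ hPA hPB Y
    rw [Matrix.mul_inv_rev]
    have : A * B * Y * (B⁻¹ * A⁻¹) = A * (B * Y * B⁻¹) * A⁻¹ := by noncomm_ring
    rw [this, hPA, hPB]

end Gauge

end SU3Fock

namespace SU3Fock

open MvPolynomial

/-! ### The ring of gauge invariants -/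

section Invariants

variable {T : Fin 8 → Matrix (Fin 3) (Fin 3) ℂ}

/-- The matrix `∑ x_A T^A` of linear forms. -/
noncomputable def genericMatrix (T : Fin 8 → Matrix (Fin 3) (Fin 3) ℂ) :
    Matrix (Fin 3) (Fin 3) Fock :=
  Matrix.of fun i j => ∑ A, C (T A i j) * X A

/-- The quadratic invariant `tr(a†a†)`. -/
noncomputable def quadInv (T : Fin 8 → Matrix (Fin 3) (Fin 3) ℂ) : Fock :=
  (genericMatrix T * genericMatrix T).trace

/-- The cubic invariant `tr(a†a†a†)`. -/
noncomputable def cubInv (T : Fin 8 → Matrix (Fin 3) (Fin 3) ℂ) : Fock :=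
  (genericMatrix T * genericMatrix T * genericMatrix T).trace

/-- All entries are multiplication operators, so traces of products of creation matrices become
multiplication by honest polynomials. -/
theorem creationMatrix_eq :
    creationMatrix T = (genericMatrix T).map (Algebra.lmul ℂ Fock) := by
  ext1 i j
  simp only [creationMatrix, genericMatrix, Matrix.of_apply, Matrix.map_apply, map_sum, map_mul]
  refine Finset.sum_congr rfl fun A _ => ?_
  refine LinearMap.ext fun p => ?_
  simp [creation, smul_eq_C_mul]

theorem trace_creationMatrix_sq :
    (creationMatrix T * creationMatrix T).trace = Algebra.lmul ℂ Fock (quadInv T) := by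
  rw [creationMatrix_eq, ← Matrix.map_mul, quadInv, AddMonoidHom.map_trace]

theorem trace_creationMatrix_cube :
    (creationMatrix T * creationMatrix T * creationMatrix T).trace =
      Algebra.lmul ℂ Fock (cubInv T) := by
  rw [creationMatrix_eq, ← Matrix.map_mul, ← Matrix.map_mul, cubInv, AddMonoidHom.map_trace]

theorem brickState_eq (j k : ℕ) : brickState T j k = quadInv T ^ j * cubInv T ^ k := by
  rw [brickState, trace_creationMatrix_sq, trace_creationMatrix_cube, ← map_pow, ← map_pow,
    ← map_mul]
  simp

theorem genericMatrix_map_eval (x : Fin 8 → ℂ) :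
    (genericMatrix T).map (eval x) = matrixOf T x := by
  ext i j
  simp [genericMatrix, matrixOf, Matrix.sum_apply, mul_comm]

theorem eval_quadInv (x : Fin 8 → ℂ) :
    eval x (quadInv T) = (matrixOf T x * matrixOf T x).trace := by
  rw [← genericMatrix_map_eval, ← Matrix.map_mul, quadInv, AddMonoidHom.map_trace]

theorem eval_cubInv (x : Fin 8 → ℂ) :
    eval x (cubInv T) = (matrixOf T x * matrixOf T x * matrixOf T x).trace := by
  rw [← genericMatrix_map_eval, ← Matrix.map_mul, ← Matrix.map_mul, cubInv,
    AddMonoidHom.map_trace]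

/-! ### Companion matrices as a slice for conjugation -/

/-- The companion matrix of `X³ - pX - q`. -/
def slice {R : Type*} [Zero R] [One R] (p q : R) : Matrix (Fin 3) (Fin 3) R :=
  !![0, 0, q; 1, 0, p; 0, 1, 0]

/-- Restriction of polynomials on the traceless matrices to the companion matrices. -/
noncomputable def restrictSlice (T : Fin 8 → Matrix (Fin 3) (Fin 3) ℂ) :
    Fock →ₐ[ℂ] MvPolynomial (Fin 2) ℂ :=
  aeval fun A => C (2 : ℂ) * ((T A).map C * slice (X 0 : MvPolynomial (Fin 2) ℂ) (X 1)).trace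

/-- The polynomial in the two invariants that restricts to a given one on companion matrices. -/
noncomputable def extendSlice (T : Fin 8 → Matrix (Fin 3) (Fin 3) ℂ) :
    MvPolynomial (Fin 2) ℂ →ₐ[ℂ] Fock :=
  -- The factors compensate tr S² = 2p and tr S³ = 3q on the companion matrix S of X³ − pX − q.
  aeval ![C (1 / 2) * quadInv T, C (1 / 3) * cubInv T]

theorem eval_restrictSlice (v : Fin 2 → ℂ) (P : Fock) :
    eval v (restrictSlice T P) = eval (coord T (slice (v 0) (v 1))) P := by
  have h : (eval v).comp (restrictSlice T).toRingHom = eval (coord T (slice (v 0) (v 1))) := by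
    refine MvPolynomial.ringHom_ext (fun a => by simp) fun A => ?_
    simp [restrictSlice, coord, slice, Matrix.trace_fin_three, Matrix.mul_apply,
      Fin.sum_univ_three]
  exact congrArg (fun f => f P) h

theorem eval_extendSlice (x : Fin 8 → ℂ) (Q : MvPolynomial (Fin 2) ℂ) :
    eval x (extendSlice T Q) =
      eval ![(1 / 2) * eval x (quadInv T), (1 / 3) * eval x (cubInv T)] Q := by
  have h : (eval x).comp (extendSlice T).toRingHom =
      eval ![(1 / 2) * eval x (quadInv T), (1 / 3) * eval x (cubInv T)] := by
    refine MvPolynomial.ringHom_ext (fun a => by simp) fun A => ?_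
    fin_cases A <;> simp [extendSlice]
  exact congrArg (fun f => f Q) h

theorem trace_slice (p q : ℂ) : (slice p q).trace = 0 := by
  simp [slice, Matrix.trace_fin_three]

theorem restrictSlice_quadInv (hT : IsSU3Generators T) :
    restrictSlice T (quadInv T) = C 2 * X 0 := by
  refine MvPolynomial.funext fun v => ?_
  rw [eval_restrictSlice, eval_quadInv, matrixOf_coord hT (trace_slice _ _)]
  simp [slice, Matrix.trace_fin_three]
  ring

theorem restrictSlice_cubInv (hT : IsSU3Generators T) :
    restrictSlice T (cubInv T) = C 3 * X 1 := by
  refine MvPolynomial.funext fun v => ?_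
  rw [eval_restrictSlice, eval_cubInv, matrixOf_coord hT (trace_slice _ _)]
  simp [slice, Matrix.trace_fin_three]
  ring

/-- The matrix with columns `e, Ye, Y²e` for the first basis vector `e`. -/
def krylov {R : Type*} [CommRing R] (Y : Matrix (Fin 3) (Fin 3) R) : Matrix (Fin 3) (Fin 3) R :=
  Matrix.of fun i j => (Y ^ (j : ℕ)) i 0

/-- Multiplication by `Y` shifts the columns e, Ye, Y²e, and Cayley–Hamilton for traceless `Y`, Y³ =
½ tr(Y²) Y + ⅓ tr(Y³), gives the last column. When the Krylov matrix is invertible it conjugates the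
companion matrix into `Y`. -/
theorem mul_krylov (Y : Matrix (Fin 3) (Fin 3) ℂ) (hY : Y.trace = 0) :
    Y * krylov Y = krylov Y * slice ((1 / 2) * (Y * Y).trace) ((1 / 3) * (Y * Y * Y).trace) := by
  have h : Y 2 2 = -Y 0 0 - Y 1 1 := by
    rw [Matrix.trace_fin_three] at hY; linear_combination hY
  ext i j
  fin_cases i <;> fin_cases j <;>
    simp [krylov, slice, Matrix.mul_apply, Fin.sum_univ_three, pow_succ, Matrix.trace_fin_three, h,
      Matrix.one_apply] <;> ring

theorem krylov_map {R S : Type*} [CommRing R] [CommRing S] (f : R →+* S)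
    (Y : Matrix (Fin 3) (Fin 3) R) : krylov (Y.map f) = (krylov Y).map f := by
  ext i j
  have : (Y.map f) ^ (j : ℕ) = (Y ^ (j : ℕ)).map f := (Matrix.map_pow Y f j).symm
  simp [krylov, this]

/-- Every gauge invariant polynomial is a polynomial in the quadratic and the cubic invariant. -/
theorem extendSlice_restrictSlice (hT : IsSU3Generators T) {P : Fock}
    (hP : ∀ A, gaugeGenerator T A P = 0) : extendSlice T (restrictSlice T P) = P := by
  -- At the nilpotent companion matrix the vectors e, Ye, Y²e are the standard basis, so this
  -- polynomial is not identically zero.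
  have hdet : (krylov (genericMatrix T)).det ≠ 0 := by
    intro h
    have h1 := congrArg (eval (coord T (slice 0 0))) h
    rw [RingHom.map_det, RingHom.mapMatrix_apply, ← krylov_map, genericMatrix_map_eval,
      matrixOf_coord hT (trace_slice _ _)] at h1
    simp [krylov, slice, Matrix.det_fin_three, pow_succ, Matrix.mul_apply, Fin.sum_univ_three] at h1
  -- Equality is only available where the Krylov determinant is nonzero; multiplying by it gives an
  -- identity everywhere, and it cancels because polynomials form a domain.
  have hmul : (extendSlice T (restrictSlice T P) - P) * (krylov (genericMatrix T)).det = 0 := by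
    refine MvPolynomial.funext fun x => ?_
    rw [map_mul, map_sub, RingHom.map_det, RingHom.mapMatrix_apply, ← krylov_map,
      genericMatrix_map_eval, map_zero, mul_eq_zero]
    by_cases hg : (krylov (matrixOf T x)).det = 0
    · exact Or.inr hg
    · left
      rw [eval_extendSlice, eval_restrictSlice, eval_quadInv, eval_cubInv, sub_eq_zero]
      have h := mul_krylov (matrixOf T x) (trace_matrixOf hT x)
      have h2 : krylov (matrixOf T x) * slice ((1 / 2) * (matrixOf T x * matrixOf T x).trace)
          ((1 / 3) * (matrixOf T x * matrixOf T x * matrixOf T x).trace) *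
          (krylov (matrixOf T x))⁻¹ = matrixOf T x := by
        rw [← h, Matrix.mul_nonsing_inv_cancel_right _ _ (isUnit_iff_ne_zero.2 hg)]
      have h3 := eval_conj hT hP _ hg (slice ((1 / 2) * (matrixOf T x * matrixOf T x).trace)
          ((1 / 3) * (matrixOf T x * matrixOf T x * matrixOf T x).trace))
      rw [h2, coord_matrixOf hT] at h3
      simpa using h3.symm
  rcases mul_eq_zero.1 hmul with h | h
  · exact sub_eq_zero.1 h
  · exact absurd h hdet

theorem genericMatrix_isHomogeneous (i j : Fin 3) : (genericMatrix T i j).IsHomogeneous 1 := by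
  change (∑ A, C (T A i j) * X A : Fock).IsHomogeneous 1
  refine IsHomogeneous.sum _ _ _ fun A _ => ?_
  exact (zero_add 1) ▸ (isHomogeneous_C (Fin 8) (T A i j)).mul (isHomogeneous_X ℂ A)

theorem quadInv_isHomogeneous : (quadInv T).IsHomogeneous 2 := by
  simp only [quadInv, Matrix.trace, Matrix.diag, Matrix.mul_apply]
  exact IsHomogeneous.sum _ _ _ fun i _ => IsHomogeneous.sum _ _ _ fun j _ =>
    (genericMatrix_isHomogeneous i j).mul (genericMatrix_isHomogeneous j i)

theorem cubInv_isHomogeneous : (cubInv T).IsHomogeneous 3 := by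
  simp only [cubInv, Matrix.trace, Matrix.diag, Matrix.mul_apply]
  exact IsHomogeneous.sum _ _ _ fun i _ => IsHomogeneous.sum _ _ _ fun j _ =>
    (IsHomogeneous.sum _ _ 2 fun k _ =>
      (genericMatrix_isHomogeneous i k).mul (genericMatrix_isHomogeneous k j)).mul
      (genericMatrix_isHomogeneous j i)

theorem brickState_isHomogeneous (j k : ℕ) : (brickState T j k).IsHomogeneous (2 * j + 3 * k) := by
  rw [brickState_eq]
  exact (quadInv_isHomogeneous.pow j).mul (cubInv_isHomogeneous.pow k)

/-- The states `|j, k⟩` are linearly independent. -/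
theorem linearIndependent_brickState (hT : IsSU3Generators T) :
    LinearIndependent ℂ fun p : ℕ × ℕ => brickState T p.1 p.2 := by
  -- On the slice |j,k⟩ becomes 2^j 3^k times the monomial with exponents (j, k).
  refine LinearIndependent.of_comp (restrictSlice T).toLinearMap ?_
  let e : ℕ × ℕ → Fin 2 →₀ ℕ := fun p => Finsupp.single 0 p.1 + Finsupp.single 1 p.2
  have he : Function.Injective e := by
    intro p q h
    have h0 := DFunLike.congr_fun h 0
    have h1 := DFunLike.congr_fun h 1
    simp [e] at h0 h1
    exact Prod.ext h0 h1
  have hb := ((basisMonomials (Fin 2) ℂ).linearIndependent.comp e he).units_smul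
    (fun p => Units.mk0 ((2 : ℂ) ^ p.1 * 3 ^ p.2)
      (mul_ne_zero (pow_ne_zero _ two_ne_zero) (pow_ne_zero _ three_ne_zero)))
  have hfun : (restrictSlice T).toLinearMap ∘ (fun p : ℕ × ℕ => brickState T p.1 p.2) =
      (fun p : ℕ × ℕ => Units.mk0 ((2 : ℂ) ^ p.1 * 3 ^ p.2)
        (mul_ne_zero (pow_ne_zero _ two_ne_zero) (pow_ne_zero _ three_ne_zero))) •
        (basisMonomials (Fin 2) ℂ ∘ e) := by
    funext p
    simp only [Function.comp_apply, AlgHom.toLinearMap_apply, brickState_eq, map_mul, map_pow,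
      restrictSlice_quadInv hT, restrictSlice_cubInv hT, coe_basisMonomials, Pi.smul_apply', e,
      Units.smul_mk0, smul_eq_C_mul, mul_pow, monomial_add_single, ← C_mul_X_pow_eq_monomial, C_1,
      one_mul]
    ring
  rw [hfun]
  exact hb

end Invariants

end SU3Fock

namespace SU3Fock

open MvPolynomial

section Differential

variable {T : Fin 8 → Matrix (Fin 3) (Fin 3) ℂ}

/-! ### Derivatives of the invariants -/

theorem quadInv_eq (hT : IsSU3Generators T) : quadInv T = ∑ A, C (1 / 2) * X A ^ 2 := by
  refine MvPolynomial.funext fun x => ?_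
  rw [eval_quadInv]
  simp only [matrixOf, Finset.sum_mul, Finset.mul_sum, Matrix.trace_sum, Matrix.smul_mul,
    Matrix.mul_smul, Matrix.trace_smul, hT.2.2, smul_eq_mul, map_sum, map_mul, eval_C, map_pow,
    eval_X]
  refine Finset.sum_congr rfl fun A _ => ?_
  rw [Finset.sum_eq_single A] <;> simp +contextual
  ring

theorem pderiv_quadInv (hT : IsSU3Generators T) (A : Fin 8) : pderiv A (quadInv T) = X A := by
  rw [quadInv_eq hT, map_sum, Finset.sum_eq_single A]
  · simp only [pderiv_C_mul, pderiv_pow, pderiv_X_self]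
    rw [C_mul']
    simp only [Nat.add_one_sub_one, pow_one, Nat.cast_ofNat, mul_one]
    rw [show (2 : Fock) = C 2 from rfl, C_mul', smul_smul]
    norm_num
  · intro B _ hB
    simp [pderiv_X_of_ne hB]
  · simp

theorem pderiv_genericMatrix (A : Fin 8) (i j : Fin 3) :
    pderiv A (genericMatrix T i j) = C (T A i j) := by
  simp [genericMatrix, pderiv_X, Pi.single_apply]

theorem pderiv_cubInv (A : Fin 8) : pderiv A (cubInv T) =
    C 3 * ((T A).map C * (genericMatrix T * genericMatrix T)).trace := by
  have h3 : (C 3 : Fock) = 3 := rfl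
  simp only [cubInv, Matrix.trace_fin_three, Matrix.mul_apply, Fin.sum_univ_three, map_add,
    Derivation.leibniz, pderiv_genericMatrix, smul_eq_mul, Matrix.map_apply, h3]
  ring

theorem pderiv_pderiv_cubInv (A : Fin 8) : pderiv A (pderiv A (cubInv T)) =
    C 6 * ((T A).map C * (T A).map C * genericMatrix T).trace := by
  have h3 : (C 3 : Fock) = 3 := rfl
  have h6 : (C 6 : Fock) = 6 := rfl
  rw [pderiv_cubInv, pderiv_C_mul]
  simp only [Matrix.trace_fin_three, Matrix.mul_apply, Fin.sum_univ_three, map_add,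
    Derivation.leibniz, pderiv_genericMatrix, smul_eq_mul, Matrix.map_apply, pderiv_C, mul_zero,
    add_zero, h3, h6]
  ring

theorem eval_pderiv_cubInv (A : Fin 8) (x : Fin 8 → ℂ) : eval x (pderiv A (cubInv T)) =
    3 * (T A * (matrixOf T x * matrixOf T x)).trace := by
  rw [pderiv_cubInv, ← genericMatrix_map_eval, ← Matrix.map_mul]
  simp [Matrix.trace_fin_three, Matrix.mul_apply, Fin.sum_univ_three]

/-- The Casimir of the fundamental representation, from contracting the Fierz identity: ½(3 − 1/3) =
4/3. It makes the cubic invariant harmonic, its Laplacian being a multiple of tr Y. -/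
theorem sum_generators_sq (hT : IsSU3Generators T) :
    ∑ A, T A * T A = (4 / 3 : ℂ) • (1 : Matrix (Fin 3) (Fin 3) ℂ) := by
  ext i k
  simp only [Matrix.sum_apply, Matrix.mul_apply]
  rw [Finset.sum_comm]
  simp only [sum_generators_mul hT]
  fin_cases i <;> fin_cases k <;> simp [Fin.sum_univ_three] <;> norm_num

theorem sum_pderiv_pderiv_cubInv (hT : IsSU3Generators T) :
    ∑ A, pderiv A (pderiv A (cubInv T)) = 0 := by
  refine MvPolynomial.funext fun x => ?_
  have h : ∀ A, eval x (pderiv A (pderiv A (cubInv T))) =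
      6 * (T A * T A * matrixOf T x).trace := by
    intro A
    rw [pderiv_pderiv_cubInv, ← genericMatrix_map_eval]
    simp [Matrix.trace_fin_three, Matrix.mul_apply, Fin.sum_univ_three]
  rw [map_sum, map_zero]
  simp only [h]
  rw [← Finset.mul_sum, ← Matrix.trace_sum, ← Finset.sum_mul, sum_generators_sq hT]
  simp [trace_matrixOf hT]

/-- Multiply the Cayley–Hamilton relation of a traceless `Y` by `Y` and take the trace. -/
theorem trace_pow_four {R : Type*} [CommRing R] (Y : Matrix (Fin 3) (Fin 3) R)
    (hY : Y.trace = 0) : 2 * (Y * Y * (Y * Y)).trace = (Y * Y).trace ^ 2 := by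
  have h : Y 2 2 = -Y 0 0 - Y 1 1 := by
    rw [Matrix.trace_fin_three] at hY; linear_combination hY
  simp only [Matrix.trace_fin_three, Matrix.mul_apply, Fin.sum_univ_three, h]
  ring

/-- The gradient of tr Y³ is governed by the traceless part of Y², so its square is (9/2)(tr Y⁴ −
(tr Y²)²/3); with tr Y⁴ = ½ (tr Y²)² the constant is (9/2)(1/2 − 1/3) = 3/4. -/
theorem sum_pderiv_cubInv_sq (hT : IsSU3Generators T) :
    ∑ A, pderiv A (cubInv T) * pderiv A (cubInv T) = C (3 / 4) * quadInv T ^ 2 := by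
  refine MvPolynomial.funext fun x => ?_
  set Y := matrixOf T x with hY
  have h : ∑ A, coord T (Y * Y) A * (T A * (Y * Y)).trace =
      (Y * Y * (Y * Y)).trace - (Y * Y).trace ^ 2 / 3 := by
    have h1 := congrArg (fun W => (W * (Y * Y)).trace) (matrixOf_coord_add hT (Y * Y))
    simp only [matrixOf, add_mul, Finset.sum_mul, Matrix.trace_add, Matrix.trace_sum,
      Matrix.smul_mul, Matrix.trace_smul, smul_eq_mul, one_mul] at h1
    linear_combination h1
  have h4 := trace_pow_four Y (trace_matrixOf hT x)
  rw [map_sum]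
  simp only [map_mul, map_pow, eval_C, eval_pderiv_cubInv, eval_quadInv, ← hY]
  have h5 : ∑ A, 3 * (T A * (Y * Y)).trace * (3 * (T A * (Y * Y)).trace) =
      (9 / 2) * ∑ A, coord T (Y * Y) A * (T A * (Y * Y)).trace := by
    rw [Finset.mul_sum]
    exact Finset.sum_congr rfl fun A _ => by rw [coord]; ring
  rw [h5, h]
  linear_combination (9 / 4) * h4

/-! ### Gauge invariance of the invariants -/

theorem gaugeGenerator_eq_zero_iff (hT : IsSU3Generators T) (A : Fin 8) (p : Fock) :
    gaugeGenerator T A p = 0 ↔ ∀ x, dirDeriv T p (matrixOf T x)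
      (T A * matrixOf T x - matrixOf T x * T A) = 0 := by
  refine ⟨fun h x => ?_, fun h => MvPolynomial.funext fun x => ?_⟩
  · have := gaugeGenerator_eval hT A p (matrixOf T x)
    rw [h] at this
    simpa using this.symm
  · have := gaugeGenerator_eval hT A p (matrixOf T x)
    rw [h, coord_matrixOf hT] at this
    simpa using this

/-- The gauge generator acts as a derivation, so its kernel is closed under products. -/
theorem gaugeGenerator_mul (hT : IsSU3Generators T) {A : Fin 8} {p q : Fock}
    (hp : gaugeGenerator T A p = 0) (hq : gaugeGenerator T A q = 0) :
    gaugeGenerator T A (p * q) = 0 := by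
  rw [gaugeGenerator_eq_zero_iff hT] at *
  intro x
  have h1 : ∀ Y W, dirDeriv T (p * q) Y W =
      eval (coord T Y) p * dirDeriv T q Y W + eval (coord T Y) q * dirDeriv T p Y W := by
    intro Y W
    simp only [dirDeriv, Derivation.leibniz, smul_eq_mul, map_add, map_mul, mul_add,
      Finset.sum_add_distrib, Finset.mul_sum]
    congr 1 <;> exact Finset.sum_congr rfl fun C _ => by ring
  rw [h1, hp, hq]
  simp

theorem gaugeGenerator_one (A : Fin 8) : gaugeGenerator T A 1 = 0 := by
  rw [gaugeGenerator_apply]; simp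

theorem gaugeGenerator_pow (hT : IsSU3Generators T) {A : Fin 8} {p : Fock}
    (hp : gaugeGenerator T A p = 0) (n : ℕ) : gaugeGenerator T A (p ^ n) = 0 := by
  induction n with
  | zero => simpa using gaugeGenerator_one A
  | succ n ih => rw [pow_succ]; exact gaugeGenerator_mul hT ih hp

theorem gaugeGenerator_quadInv (hT : IsSU3Generators T) (A : Fin 8) :
    gaugeGenerator T A (quadInv T) = 0 := by
  rw [gaugeGenerator_eq_zero_iff hT]
  intro x
  simp only [dirDeriv, pderiv_quadInv hT, eval_X, coord_matrixOf hT]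
  set Y := matrixOf T x with hY
  have h : ∀ W, ∑ B, coord T W B * x B = 2 * (Y * W).trace := by
    intro W
    simp only [hY, matrixOf, Finset.sum_mul, Matrix.trace_sum, Matrix.smul_mul, Matrix.trace_smul,
      smul_eq_mul, coord, Finset.mul_sum]
    exact Finset.sum_congr rfl fun B _ => by ring
  rw [h, mul_sub, Matrix.trace_sub, ← mul_assoc, ← mul_assoc, Matrix.trace_mul_comm (Y * T A)]
  simp [mul_assoc]

theorem gaugeGenerator_cubInv (hT : IsSU3Generators T) (A : Fin 8) :
    gaugeGenerator T A (cubInv T) = 0 := by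
  rw [gaugeGenerator_eq_zero_iff hT]
  intro x
  simp only [dirDeriv, eval_pderiv_cubInv, coord_matrixOf hT]
  set Y := matrixOf T x with hY
  have hW : (T A * Y - Y * T A).trace = 0 := by
    rw [Matrix.trace_sub, Matrix.trace_mul_comm, sub_self]
  have h1 := congrArg (fun W => (W * (Y * Y)).trace) (matrixOf_coord hT hW)
  simp only [matrixOf, Finset.sum_mul, Matrix.trace_sum,
    Matrix.smul_mul, Matrix.trace_smul, smul_eq_mul] at h1
  have h2 : ∑ B, coord T (T A * Y - Y * T A) B * (3 * (T B * (Y * Y)).trace) =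
      3 * ∑ B, coord T (T A * Y - Y * T A) B * (T B * (Y * Y)).trace := by
    rw [Finset.mul_sum]; exact Finset.sum_congr rfl fun B _ => by ring
  rw [h2, h1, sub_mul, Matrix.trace_sub, mul_assoc Y, Matrix.trace_mul_comm Y]
  simp [mul_assoc]

theorem gaugeGenerator_brickState (hT : IsSU3Generators T) (A : Fin 8) (j k : ℕ) :
    gaugeGenerator T A (brickState T j k) = 0 := by
  rw [brickState_eq]
  exact gaugeGenerator_mul hT (gaugeGenerator_pow hT (gaugeGenerator_quadInv hT A) j)
    (gaugeGenerator_pow hT (gaugeGenerator_cubInv hT A) k)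

/-! ### The cut space -/

theorem cutProjection_of_le {N m : ℕ} {p : Fock} (hp : p.IsHomogeneous m) (hm : m ≤ N) :
    cutProjection N p = p := by
  simp only [cutProjection, LinearMap.sum_apply]
  rw [Finset.sum_eq_single m]
  · simpa using homogeneousComponent_of_mem (n := m) (m := m) hp
  · intro n _ hn
    exact (homogeneousComponent_of_mem (n := m) (m := n) hp).trans (if_neg hn)
  · intro h; simp at h; omega

theorem cutProjection_of_lt {N m : ℕ} {p : Fock} (hp : p.IsHomogeneous m) (hm : N < m) :
    cutProjection N p = 0 := by
  simp only [cutProjection, LinearMap.sum_apply]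
  refine Finset.sum_eq_zero fun n hn => ?_
  have : n ≠ m := by have := Finset.mem_range.1 hn; omega
  exact (homogeneousComponent_of_mem (n := m) (m := n) hp).trans (if_neg this)

theorem cutProjection_of_totalDegree_le {N : ℕ} {p : Fock} (hp : p.totalDegree ≤ N) :
    cutProjection N p = p := by
  simp only [cutProjection, LinearMap.sum_apply]
  refine Eq.trans (Eq.symm ?_) (sum_homogeneousComponent p)
  refine Finset.sum_subset (Finset.range_mono (by omega)) fun n _ hn => ?_
  refine homogeneousComponent_eq_zero _ _ ?_
  rw [Finset.mem_range] at hn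
  omega

theorem mem_brickIndices {N : ℕ} {p : ℕ × ℕ} : p ∈ brickIndices N ↔ 2 * p.1 + 3 * p.2 ≤ N := by
  simp only [brickIndices, Finset.mem_filter, Finset.mem_product, Finset.mem_range]
  omega

theorem mem_cutSpace {N : ℕ} {p : Fock} :
    p ∈ cutSpace T N ↔ (∀ A, gaugeGenerator T A p = 0) ∧ p.totalDegree ≤ N := by
  simp [cutSpace, Submodule.mem_iInf, mem_restrictTotalDegree]

theorem brickState_mem_cutSpace (hT : IsSU3Generators T) {N j k : ℕ} (h : 2 * j + 3 * k ≤ N) :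
    brickState T j k ∈ cutSpace T N :=
  mem_cutSpace.2 ⟨fun A => gaugeGenerator_brickState hT A j k,
    (brickState_isHomogeneous j k).totalDegree_le.trans h⟩

theorem extendSlice_mem_span (Q : MvPolynomial (Fin 2) ℂ) : extendSlice T Q ∈
    Submodule.span ℂ (Set.range fun p : ℕ × ℕ => brickState T p.1 p.2) := by
  induction Q using MvPolynomial.induction_on' with
  | monomial u a =>
    have : extendSlice T (monomial u a) =
        (a * ((1 / 2) ^ u 0 * (1 / 3) ^ u 1)) • brickState T (u 0) (u 1) := by
      rw [extendSlice, aeval_monomial, brickState_eq, smul_eq_C_mul,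
        Finsupp.prod_fintype _ _ (by simp)]
      simp only [Fin.prod_univ_two, mul_pow, algebraMap_eq, Matrix.cons_val_zero,
        Matrix.cons_val_one, map_mul, map_pow]
      ring
    rw [this]
    exact Submodule.smul_mem _ _ (Submodule.subset_span ⟨(u 0, u 1), rfl⟩)
  | add p q hp hq => rw [map_add]; exact Submodule.add_mem _ hp hq

/-- The states `|j, k⟩` with at most `N` quanta span the cut space. -/
theorem span_brickState (hT : IsSU3Generators T) (N : ℕ) :
    Submodule.span ℂ (Set.range fun p : brickIndices N => brickState T p.1.1 p.1.2) =
      cutSpace T N := by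
  apply le_antisymm
  · rw [Submodule.span_le]
    rintro _ ⟨p, rfl⟩
    exact brickState_mem_cutSpace hT (mem_brickIndices.1 p.2)
  · intro P hP
    rw [mem_cutSpace] at hP
    -- The expansion of `P` in the states |j,k⟩ carries no degree bound. Projecting it fixes `P` and
    -- keeps or kills each homogeneous |j,k⟩ entirely.
    rw [← cutProjection_of_totalDegree_le hP.2]
    have h := extendSlice_mem_span (T := T) (restrictSlice T P)
    rw [extendSlice_restrictSlice hT hP.1] at h
    have h2 : cutProjection N P ∈ (Submodule.span ℂ
        (Set.range fun p : ℕ × ℕ => brickState T p.1 p.2)).map (cutProjection N) :=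
      Submodule.mem_map_of_mem h
    rw [Submodule.map_span] at h2
    refine Submodule.span_le.2 ?_ h2
    rintro _ ⟨_, ⟨p, rfl⟩, rfl⟩
    rcases le_or_gt (2 * p.1 + 3 * p.2) N with hp | hp
    · rw [cutProjection_of_le (brickState_isHomogeneous _ _) hp]
      exact Submodule.subset_span ⟨⟨p, mem_brickIndices.2 hp⟩, rfl⟩
    · rw [cutProjection_of_lt (brickState_isHomogeneous _ _) hp]
      exact Submodule.zero_mem _

/-! ### The Laplacian and the Hamiltonian -/

/-- The Laplacian `∑ ∂_A²`. -/
noncomputable def laplacian : Module.End ℂ Fock := ∑ A, annihilation A * annihilation A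

theorem laplacian_apply (p : Fock) : laplacian p = ∑ A, pderiv A (pderiv A p) := by
  simp [laplacian, annihilation]

theorem laplacian_mul (p q : Fock) : laplacian (p * q) =
    p * laplacian q + q * laplacian p + 2 * ∑ A, pderiv A p * pderiv A q := by
  simp only [laplacian_apply, Derivation.leibniz, map_add, smul_eq_mul, Finset.mul_sum,
    ← Finset.sum_add_distrib]
  exact Finset.sum_congr rfl fun A _ => by ring

theorem laplacian_quadInv (hT : IsSU3Generators T) : laplacian (quadInv T) = 8 := by
  simp [laplacian_apply, pderiv_quadInv hT]

theorem laplacian_cubInv (hT : IsSU3Generators T) : laplacian (cubInv T) = 0 := by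
  rw [laplacian_apply, sum_pderiv_pderiv_cubInv hT]

/-- The sl₂ commutation relation: 8 is the Laplacian of the quadratic invariant, and the cross term
is 2m by Euler's identity. -/
theorem laplacian_quadInv_mul (hT : IsSU3Generators T) {m : ℕ} {g : Fock}
    (hg : g.IsHomogeneous m) :
    laplacian (quadInv T * g) = quadInv T * laplacian g + (8 + 2 * m : ℂ) • g := by
  rw [laplacian_mul, laplacian_quadInv hT]
  simp only [pderiv_quadInv hT, hg.sum_X_mul_pderiv, nsmul_eq_mul, smul_eq_C_mul]
  simp only [map_add, map_mul, map_natCast, map_ofNat]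
  ring

/-- Commuting Δ past n factors adds up 8 + 2(m + 2i) for i < n, which is 2n(n + 3 + m). The
truncated exponent at `n = 0` is harmless because its coefficient vanishes. -/
theorem laplacian_quadInv_pow_mul (hT : IsSU3Generators T) {m : ℕ} {g : Fock}
    (hg : g.IsHomogeneous m) (n : ℕ) :
    laplacian (quadInv T ^ n * g) = quadInv T ^ n * laplacian g +
      (2 * n * (n + 3 + m) : ℂ) • (quadInv T ^ (n - 1) * g) := by
  induction n with
  | zero => simp
  | succ n ih =>
    have hn : ((2 * n * (n + 3 + m) : ℂ) • (quadInv T ^ (n - 1) * g)) * quadInv T =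
        (2 * n * (n + 3 + m) : ℂ) • (quadInv T ^ n * g) := by
      cases n with
      | zero => simp
      | succ n => rw [Nat.add_sub_cancel, smul_mul_assoc, pow_succ]; congr 1; ring
    rw [pow_succ', mul_assoc, laplacian_quadInv_mul hT ((quadInv_isHomogeneous.pow n).mul hg), ih,
      mul_add, mul_comm (quadInv T) (_ • _), hn, Nat.add_sub_cancel]
    rw [← mul_assoc, add_assoc, ← add_smul]
    congr 2
    push_cast
    ring

theorem laplacian_cubInv_pow (hT : IsSU3Generators T) (k : ℕ) :
    laplacian (cubInv T ^ k) =
      ((3 / 4) * k * (k - 1) : ℂ) • (quadInv T ^ 2 * cubInv T ^ (k - 2)) := by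
  induction k with
  | zero => simp [laplacian_apply]
  | succ k ih =>
    have h1 : ∑ A, pderiv A (cubInv T) * pderiv A (cubInv T ^ k) =
        C (3 / 4 * k : ℂ) * quadInv T ^ 2 * cubInv T ^ (k - 1) := by
      have h2 : ∀ A, pderiv A (cubInv T) * pderiv A (cubInv T ^ k) =
          (k * cubInv T ^ (k - 1)) * (pderiv A (cubInv T) * pderiv A (cubInv T)) := by
        intro A
        rw [pderiv_pow]; ring
      simp only [h2, ← Finset.mul_sum, sum_pderiv_cubInv_sq hT, map_mul, map_natCast]
      ring
    rw [pow_succ', laplacian_mul, laplacian_cubInv hT, h1, ih]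
    rcases k with _ | _ | k
    · simp
    · have e1 : 0 + 1 - 1 = 0 := rfl
      simp only [e1, smul_eq_C_mul, map_mul, map_sub, Nat.cast_add, Nat.cast_zero,
        Nat.cast_one, map_add, map_one, map_zero]
      ring
    · have e1 : k + 1 + 1 - 2 = k := rfl
      have e2 : k + 1 + 1 - 1 = k + 1 := rfl
      have e3 : k + 1 + 1 + 1 - 2 = k + 1 := rfl
      simp only [e1, e2, e3, smul_eq_C_mul, map_mul, map_sub, map_natCast, Nat.cast_add,
        Nat.cast_one, map_add, map_one]
      ring

theorem laplacian_brickState (hT : IsSU3Generators T) (j k : ℕ) :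
    laplacian (brickState T j k) =
      (2 * j * (j + 3 + 3 * k) : ℂ) • brickState T (j - 1) k +
      ((3 / 4) * k * (k - 1) : ℂ) • brickState T (j + 2) (k - 2) := by
  simp only [brickState_eq]
  rw [laplacian_quadInv_pow_mul hT (cubInv_isHomogeneous.pow k), laplacian_cubInv_pow hT,
    mul_smul_comm, ← mul_assoc, ← pow_add, add_comm]
  push_cast
  rfl

/-- Stated over a possibly noncommutative algebra because the matrix entries are operators; the
input is the normalization of `tr (T A * T B)`. -/
theorem trace_mul_of_generators (hT : IsSU3Generators T) {R : Type*} [Ring R] [Algebra ℂ R]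
    (u v : Fin 8 → R) :
    ((Matrix.of fun i j => ∑ A, T A i j • u A : Matrix (Fin 3) (Fin 3) R) *
      (Matrix.of fun i j => ∑ A, T A i j • v A : Matrix (Fin 3) (Fin 3) R)).trace =
      (1 / 2 : ℂ) • ∑ A, u A * v A := by
  have h : ∀ A B, ∑ i, ∑ j, (T A i j * T B j i) • (u A * v B) =
      (if A = B then 1 / 2 else 0 : ℂ) • (u A * v B) := by
    intro A B
    rw [← hT.2.2 A B]
    simp only [Matrix.trace, Matrix.diag, Matrix.mul_apply, Finset.sum_smul]
  simp only [Matrix.trace, Matrix.diag, Matrix.mul_apply, Matrix.of_apply, Finset.sum_mul_sum,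
    smul_mul_smul_comm]
  calc ∑ i, ∑ j, ∑ A, ∑ B, (T A i j * T B j i) • (u A * v B)
      = ∑ A, ∑ B, ∑ i, ∑ j, (T A i j * T B j i) • (u A * v B) := by
        simp only [Fin.sum_univ_three, Finset.sum_add_distrib]
    _ = (1 / 2 : ℂ) • ∑ A, u A * v A := by
        simp only [h, Finset.smul_sum]
        refine Finset.sum_congr rfl fun A _ => ?_
        rw [Finset.sum_eq_single A] <;> simp +contextual [eq_comm]

theorem hamiltonian_apply (hT : IsSU3Generators T) {m : ℕ} {p : Fock} (hp : p.IsHomogeneous m) :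
    hamiltonian T p =
      (m / 2 + 2 : ℂ) • p - (1 / 2 : ℂ) • (quadInv T * p) - (1 / 4 : ℂ) • laplacian p := by
  have h1 : (annihilationMatrix T * annihilationMatrix T).trace = (1 / 2 : ℂ) • laplacian :=
    trace_mul_of_generators hT annihilation annihilation
  have h2 : (creationMatrix T * annihilationMatrix T).trace p = (m / 2 : ℂ) • p := by
    have h3 : (creationMatrix T * annihilationMatrix T).trace =
        (1 / 2 : ℂ) • ∑ A, creation A * annihilation A :=
      trace_mul_of_generators hT creation annihilation
    have h4 := hp.sum_X_mul_pderiv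
    rw [h3]
    simp only [LinearMap.smul_apply, LinearMap.sum_apply, Module.End.mul_apply, creation,
      annihilation, LinearMap.mulLeft_apply, Derivation.coeFn_coe, h4]
    rw [← Nat.cast_smul_eq_nsmul ℂ, smul_smul]
    congr 1; ring
  simp only [hamiltonian, LinearMap.sub_apply, LinearMap.add_apply, h2, LinearMap.smul_apply, h1,
    trace_creationMatrix_sq, Module.End.one_apply, Algebra.coe_lmul_eq_mul,
    LinearMap.mul_apply', smul_smul]
  module

end Differential

end SU3Fock

namespace SU3Fock

open Polynomial

section Laguerre

/-! ### Zeros of the Laguerre polynomials -/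

/-- Dividing by the Gamma factor cancels the numerator of the binomial coefficient; the resulting
closed form is what the recurrences are checked against. -/
theorem sonine_coeff (n α i : ℕ) : (sonine n α).coeff i =
    if i ≤ n then (-1) ^ i / ((i.factorial : ℝ) * (n - i).factorial * (α + i).factorial)
    else 0 := by
  have hG : Real.Gamma ((n : ℝ) + α + 1) = ((n + α).factorial : ℝ) := by
    have := Real.Gamma_nat_eq_factorial (n + α)
    push_cast at this
    exact this
  simp only [sonine, laguerre, coeff_C_mul, finsetSum_coeff, coeff_X_pow, hG, mul_ite, mul_one,
    mul_zero, Finset.sum_ite_eq, Finset.mem_range, Nat.lt_succ_iff]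
  split_ifs with h1
  · have h3 := Nat.choose_mul_factorial_mul_factorial (show n - i ≤ n + α by omega)
    have h4 : n + α - (n - i) = α + i := by omega
    rw [h4] at h3
    have h5 : ((n + α).choose (n - i) : ℝ) * (n - i).factorial * (α + i).factorial =
        (n + α).factorial := by exact_mod_cast h3
    rw [← h5]
    have h6 : ((n + α).choose (n - i) : ℝ) ≠ 0 := by
      exact_mod_cast (Nat.choose_pos (by omega)).ne'
    have := Nat.factorial_ne_zero i
    have := Nat.factorial_ne_zero (n - i)
    have := Nat.factorial_ne_zero (α + i)
    field_simp
  · rfl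

theorem sonine_natDegree (n α : ℕ) : (sonine n α).natDegree = n := by
  refine natDegree_eq_of_le_of_coeff_ne_zero ?_ ?_
  · rw [natDegree_le_iff_coeff_eq_zero]
    intro i hi
    rw [sonine_coeff, if_neg (by omega)]
  · rw [sonine_coeff, if_pos le_rfl]
    positivity

theorem sonine_recurrence_zero (α : ℕ) :
    C ((1 : ℝ) + α) * sonine 1 α = (C (1 + α : ℝ) - X) * sonine 0 α := by
  ext i
  rw [sub_mul, coeff_sub, coeff_C_mul, coeff_C_mul]
  rcases i with _ | _ | i
  · simp [sonine_coeff]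
  · simp only [coeff_X_mul, sonine_coeff, Nat.factorial_succ, ← add_assoc]
    simp
    field_simp
    ring
  · simp [coeff_X_mul, sonine_coeff]

theorem sonine_recurrence (n α : ℕ) :
    C (((n : ℝ) + 2) * (n + 2 + α)) * sonine (n + 2) α =
      (C (2 * n + 3 + α : ℝ) - X) * sonine (n + 1) α - sonine n α := by
  ext i
  rw [coeff_sub, sub_mul, coeff_sub, coeff_C_mul, coeff_C_mul]
  rcases i with _ | i
  · simp only [mul_coeff_zero, coeff_X_zero, sonine_coeff, Nat.factorial_succ, Nat.zero_le, if_true,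
      Nat.sub_zero, add_zero]
    push_cast
    field_simp
    ring
  · rw [coeff_X_mul]
    simp only [sonine_coeff]
    -- Near the top degree some of the four coefficients vanish, so those degrees are checked
    -- separately.
    rcases lt_trichotomy i n with h | h | h
    · obtain ⟨u, rfl⟩ : ∃ u, n = i + 1 + u := ⟨n - (i + 1), by omega⟩
      rw [if_pos (by omega), if_pos (by omega), if_pos (by omega), if_pos (by omega),
        show i + 1 + u + 2 - (i + 1) = u + 2 by omega,
        show i + 1 + u + 1 - (i + 1) = u + 1 by omega,
        show i + 1 + u + 1 - i = u + 2 by omega, show i + 1 + u - (i + 1) = u by omega,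
        ← add_assoc]
      simp only [Nat.factorial_succ]
      push_cast
      field_simp
      ring
    · subst h
      rw [if_pos (by omega), if_pos (by omega), if_pos (by omega), if_neg (by omega),
        show i + 2 - (i + 1) = 1 by omega, show i + 1 - (i + 1) = 0 by omega,
        show i + 1 - i = 1 by omega, ← add_assoc]
      simp only [Nat.factorial_succ, Nat.factorial_zero]
      push_cast
      field_simp
      ring
    · rcases (show i = n + 1 ∨ n + 2 ≤ i by omega) with h1 | h1
      · subst h1
        rw [if_pos (by omega), if_neg (by omega), if_pos (by omega), if_neg (by omega),
          show n + 2 - (n + 1 + 1) = 0 by omega, show n + 1 - (n + 1) = 0 by omega]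
        simp only [Nat.factorial_succ, Nat.factorial_zero, ← add_assoc]
        push_cast
        field_simp
        ring
      · rw [if_neg (by omega), if_neg (by omega), if_neg (by omega), if_neg (by omega)]
        simp

theorem sonine_zero_eq (α : ℕ) : sonine 0 α = C ((α.factorial : ℝ)⁻¹) := by
  rw [eq_C_of_natDegree_eq_zero (sonine_natDegree 0 α), sonine_coeff]
  simp

/-- The Christoffel–Darboux identity for conjugate points. -/
theorem sonine_darboux (n α : ℕ) (z : ℂ) : ∃ S : ℝ, 0 < S ∧
    aeval z (sonine (n + 1) α) * aeval (star z) (sonine n α) -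
      aeval z (sonine n α) * aeval (star z) (sonine (n + 1) α) = (star z - z) * S := by
  have hconj : ∀ p : ℝ[X], aeval (star z) p = star (aeval z p) := fun p => by
    have := Polynomial.aeval_conj p z
    simpa using this
  induction n with
  | zero =>
    have h0 : (1 + α : ℝ) ≠ 0 := by positivity
    have hc : (0 : ℝ) < (α.factorial : ℝ)⁻¹ := by positivity
    have h1 := congrArg (aeval z) (sonine_recurrence_zero α)
    have h2 := congrArg (aeval (star z)) (sonine_recurrence_zero α)
    simp only [sonine_zero_eq, map_mul, map_sub, aeval_C, aeval_X, Complex.coe_algebraMap] at h1 h2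
    have h0' : ((1 + α : ℝ) : ℂ) ≠ 0 := by exact_mod_cast h0
    refine ⟨(α.factorial : ℝ)⁻¹ ^ 2 / (1 + α), by positivity, mul_left_cancel₀ h0' ?_⟩
    simp only [sonine_zero_eq, aeval_C, Complex.coe_algebraMap, zero_add]
    have h3 : ((1 + α : ℝ) : ℂ) * (((α.factorial : ℝ)⁻¹ ^ 2 / (1 + α) : ℝ) : ℂ) =
        (((α.factorial : ℝ)⁻¹ : ℝ) : ℂ) ^ 2 := by
      rw [← Complex.ofReal_mul, ← Complex.ofReal_pow]
      congr 1
      field_simp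
    linear_combination (((α.factorial : ℝ)⁻¹ : ℝ) : ℂ) * h1 -
      (((α.factorial : ℝ)⁻¹ : ℝ) : ℂ) * h2 - (star z - z) * h3
  | succ n ih =>
    obtain ⟨S, hS, ih⟩ := ih
    have h0 : (((n : ℝ) + 2) * (n + 2 + α) : ℝ) ≠ 0 := by positivity
    have h0' : ((((n : ℝ) + 2) * (n + 2 + α) : ℝ) : ℂ) ≠ 0 := by exact_mod_cast h0
    have h1 := congrArg (aeval z) (sonine_recurrence n α)
    have h2 := congrArg (aeval (star z)) (sonine_recurrence n α)
    simp only [map_mul, map_sub, aeval_C, aeval_X] at h1 h2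
    have hsq : aeval z (sonine (n + 1) α) * aeval (star z) (sonine (n + 1) α) =
        (Complex.normSq (aeval z (sonine (n + 1) α)) : ℂ) := by
      rw [hconj]
      exact Complex.mul_conj _
    have hn := Complex.normSq_nonneg (aeval z (sonine (n + 1) α))
    -- The recurrence turns the new difference into the old one plus (z̄ − z)|L_{n+1}(z)|², up to
    -- the leading factor, so positivity is inherited from `S`.
    refine ⟨(S + Complex.normSq (aeval z (sonine (n + 1) α))) / (((n : ℝ) + 2) * (n + 2 + α)),
      by positivity, mul_left_cancel₀ h0' ?_⟩
    have h3 : ((((n : ℝ) + 2) * (n + 2 + α) : ℝ) : ℂ) *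
        (((S + Complex.normSq (aeval z (sonine (n + 1) α))) /
          (((n : ℝ) + 2) * (n + 2 + α)) : ℝ) : ℂ) =
        S + (Complex.normSq (aeval z (sonine (n + 1) α)) : ℂ) := by
      rw [← Complex.ofReal_mul, ← Complex.ofReal_add]
      congr 1
      field_simp
    simp only [Complex.coe_algebraMap] at h1 h2
    rw [← Complex.ofReal_mul] at h1 h2
    linear_combination aeval (star z) (sonine (n + 1) α) * h1 -
      aeval z (sonine (n + 1) α) * h2 - (star z - z) * h3 + ih + (star z - z) * hsq

/-- The confluent form of the Christoffel–Darboux identity: the Wronskian is negative. -/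
theorem sonine_wronskian_neg (n α : ℕ) (x : ℝ) :
    (derivative (sonine (n + 1) α)).eval x * (sonine n α).eval x -
      (derivative (sonine n α)).eval x * (sonine (n + 1) α).eval x < 0 := by
  induction n with
  | zero =>
    have h0 : (0 : ℝ) < 1 + α := by positivity
    have hc : (0 : ℝ) < (α.factorial : ℝ)⁻¹ := by positivity
    have h1 := congrArg (fun p => (derivative p).eval x) (sonine_recurrence_zero α)
    simp only [sonine_zero_eq, derivative_mul, derivative_C, derivative_sub, derivative_X, eval_add,
      eval_mul, eval_C, eval_sub, eval_zero, eval_one] at h1 ⊢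
    simp only [zero_add, zero_mul, zero_sub, mul_zero, add_zero, sub_zero] at h1 ⊢
    have h2 : (derivative (sonine 1 α)).eval x = -(α.factorial : ℝ)⁻¹ / (1 + α) := by
      rw [eq_div_iff h0.ne']
      linear_combination h1
    rw [h2]
    have : 0 < (α.factorial : ℝ)⁻¹ / (1 + α) * (α.factorial : ℝ)⁻¹ := by positivity
    rw [neg_div, neg_mul]
    linarith
  | succ n ih =>
    have h0 : (0 : ℝ) < ((n : ℝ) + 2) * (n + 2 + α) := by positivity
    have h1 := congrArg (fun p => (derivative p).eval x) (sonine_recurrence n α)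
    have h2 := congrArg (fun p => p.eval x) (sonine_recurrence n α)
    simp only [derivative_mul, derivative_C, derivative_sub, derivative_X, eval_add,
      eval_mul, eval_C, eval_sub, eval_zero, eval_one, eval_X] at h1 h2
    have h3 : (((n : ℝ) + 2) * (n + 2 + α)) *
        ((derivative (sonine (n + 1 + 1) α)).eval x * (sonine (n + 1) α).eval x -
          (derivative (sonine (n + 1) α)).eval x * (sonine (n + 1 + 1) α).eval x) < 0 := by
      have h4 := sq_nonneg ((sonine (n + 1) α).eval x)
      have h5 : (((n : ℝ) + 2) * (n + 2 + α)) *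
        ((derivative (sonine (n + 1 + 1) α)).eval x * (sonine (n + 1) α).eval x -
          (derivative (sonine (n + 1) α)).eval x * (sonine (n + 1 + 1) α).eval x) =
          ((derivative (sonine (n + 1) α)).eval x * (sonine n α).eval x -
            (derivative (sonine n α)).eval x * (sonine (n + 1) α).eval x) -
            (sonine (n + 1) α).eval x ^ 2 := by
        linear_combination (sonine (n + 1) α).eval x * h1 -
          (derivative (sonine (n + 1) α)).eval x * h2
      rw [h5]
      linarith
    exact neg_of_mul_neg_right h3 h0.le

/-- All zeros are real. -/
theorem sonine_root_real {d α : ℕ} {z : ℂ} (hz : aeval z (sonine d α) = 0) : (z.re : ℂ) = z := by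
  rcases d with _ | n
  · rw [sonine_zero_eq, aeval_C] at hz
    have := Nat.factorial_ne_zero α
    simp [this] at hz
  -- The conjugate of a root is a root, so the left side of the Darboux identity vanishes and `S >
  -- 0` forces z̄ = z.
  · obtain ⟨S, hS, h⟩ := sonine_darboux n α z
    have h2 : aeval (star z) (sonine (n + 1) α) = 0 := by
      have := Polynomial.aeval_conj (sonine (n + 1) α) z
      simpa [hz] using this
    rw [hz, h2] at h
    have h3 : star z - z = 0 := by
      rcases mul_eq_zero.1 (h.symm.trans (by ring)) with h | h
      · exact h
      · exact absurd (by exact_mod_cast h) hS.ne'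
    exact Complex.conj_eq_iff_re.1 (sub_eq_zero.1 h3)

theorem aeval_ofReal (p : ℝ[X]) (x : ℝ) : aeval (x : ℂ) p = ((p.eval x : ℝ) : ℂ) := by
  have := aeval_algebraMap_apply ℂ x p
  simpa [aeval_def] using this

/-- A common root of the polynomial and its derivative would be real and would make the strictly
negative Wronskian vanish. -/
theorem sonine_separable (d α : ℕ) : (sonine d α).Separable := by
  rcases d with _ | n
  · rw [sonine_zero_eq]
    exact (separable_C _).2 (isUnit_iff_ne_zero.2 (by positivity))
  · rw [Separable, isCoprime_iff_aeval_ne_zero_of_isAlgClosed ℝ ℂ]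
    intro z
    by_contra! h
    obtain ⟨h1, h2⟩ := h
    have hr := sonine_root_real h1
    rw [← hr, aeval_ofReal] at h1 h2
    have h3 := sonine_wronskian_neg n α z.re
    rw [Complex.ofReal_eq_zero.1 h1, Complex.ofReal_eq_zero.1 h2] at h3
    simp at h3

/-- The coefficients alternate in sign, so for x ≤ 0 every term is nonnegative and the constant term
is positive. Hence all energies are positive. -/
theorem sonine_eval_pos (d α : ℕ) {x : ℝ} (hx : x ≤ 0) : 0 < (sonine d α).eval x := by
  rw [eval_eq_sum_range]
  have hterm : ∀ i, i ≤ d → (sonine d α).coeff i * x ^ i =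
      (-x) ^ i / ((i.factorial : ℝ) * (d - i).factorial * (α + i).factorial) := by
    intro i hi
    rw [sonine_coeff, if_pos hi, neg_pow x]
    ring
  rw [sonine_natDegree]
  refine Finset.sum_pos' (fun i hi => ?_) ⟨0, by simp, ?_⟩
  · rw [hterm i (by simpa [Nat.lt_succ_iff] using hi)]
    have : 0 ≤ -x := by linarith
    positivity
  · rw [hterm 0 (Nat.zero_le d)]
    simp only [pow_zero]
    positivity

/-- `sonine d α` has exactly `d` real zeros. -/
theorem ncard_sonine_roots (d α : ℕ) :
    {E : ℝ | (sonine d α).eval (2 * E) = 0}.ncard = d := by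
  have hinj : Function.Injective fun E : ℝ => ((2 * E : ℝ) : ℂ) := by
    intro a b h
    have := Complex.ofReal_injective h
    linarith
  have h0 : sonine d α ≠ 0 := (sonine_separable d α).ne_zero
  have himg : (fun E : ℝ => ((2 * E : ℝ) : ℂ)) '' {E : ℝ | (sonine d α).eval (2 * E) = 0} =
      (sonine d α).rootSet ℂ := by
    ext z
    rw [mem_rootSet]
    constructor
    · rintro ⟨E, hE, rfl⟩
      refine ⟨h0, ?_⟩
      rw [aeval_ofReal, show (sonine d α).eval (2 * E) = 0 from hE, Complex.ofReal_zero]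
    · rintro ⟨_, hz⟩
      have hr := sonine_root_real hz
      rw [← hr, aeval_ofReal, Complex.ofReal_eq_zero] at hz
      refine ⟨z.re / 2, ?_, ?_⟩
      · rw [Set.mem_ofPred_eq, mul_div_cancel₀ _ two_ne_zero]; exact hz
      · simp only [mul_div_cancel₀ z.re (two_ne_zero' ℝ)]; exact hr
  rw [← Set.ncard_image_of_injective _ hinj, himg, ← Nat.card_coe_set_eq, Nat.card_eq_fintype_card,
    card_rootSet_eq_natDegree (sonine_separable d α) (IsAlgClosed.splits _), sonine_natDegree]

end Laguerre
end SU3Fock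

namespace SU3Fock

section Sectors

variable {T : Fin 8 → Matrix (Fin 3) (Fin 3) ℂ}

/-! ### Harmonic polynomials in the invariants -/

/-- The coefficient of `|3t, K - 2t⟩` in the harmonic polynomial with leading term `|0, K⟩`. -/
noncomputable def harmonicCoeff (K t : ℕ) : ℂ :=
  ((-24 : ℂ) ^ t)⁻¹ *
    (((K - t).factorial : ℂ) / ((t.factorial : ℂ) * ((K - 2 * t).factorial : ℂ)))

theorem harmonicCoeff_ne_zero (K t : ℕ) : harmonicCoeff K t ≠ 0 := by
  have h1 : ((K - t).factorial : ℂ) ≠ 0 := by exact_mod_cast Nat.factorial_ne_zero _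
  have h2 : (t.factorial : ℂ) ≠ 0 := by exact_mod_cast Nat.factorial_ne_zero _
  have h3 : ((K - 2 * t).factorial : ℂ) ≠ 0 := by exact_mod_cast Nat.factorial_ne_zero _
  have h4 : ((-24 : ℂ) ^ t) ≠ 0 := pow_ne_zero _ (by norm_num)
  exact mul_ne_zero (inv_ne_zero h4) (div_ne_zero h1 (mul_ne_zero h2 h3))

theorem harmonicCoeff_zero (K : ℕ) : harmonicCoeff K 0 = 1 := by
  have h1 : (K.factorial : ℂ) ≠ 0 := by exact_mod_cast Nat.factorial_ne_zero _
  simp [harmonicCoeff, h1]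

/-- This is the cancellation needed for harmonicity: 18(t+1)(K−t) is 2j(j+3+3k) at j = 3(t+1), k = K
− 2(t+1), and the right side comes from Δ acting on the power of the cubic invariant. -/
theorem harmonicCoeff_succ {K t : ℕ} (h : 2 * t + 2 ≤ K) :
    harmonicCoeff K (t + 1) * (18 * (t + 1) * (K - t)) =
      -(harmonicCoeff K t * ((3 / 4) * (K - 2 * t) * (K - 2 * t - 1))) := by
  obtain ⟨u, rfl⟩ : ∃ u, K = 2 * t + 2 + u := ⟨K - (2 * t + 2), by omega⟩
  have h1 : ((t + 1 + u).factorial : ℂ) ≠ 0 := by exact_mod_cast Nat.factorial_ne_zero _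
  have h2 : (t.factorial : ℂ) ≠ 0 := by exact_mod_cast Nat.factorial_ne_zero _
  have h3 : (u.factorial : ℂ) ≠ 0 := by exact_mod_cast Nat.factorial_ne_zero _
  have h4 : ((-24 : ℂ) ^ t) ≠ 0 := pow_ne_zero _ (by norm_num)
  have h5 : (t : ℂ) + 1 ≠ 0 := by exact_mod_cast Nat.succ_ne_zero t
  have h6 : (u : ℂ) + 1 ≠ 0 := by exact_mod_cast Nat.succ_ne_zero u
  have h7 : (u : ℂ) + 1 + 1 ≠ 0 := by exact_mod_cast Nat.succ_ne_zero (u + 1)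
  simp only [harmonicCoeff]
  rw [show 2 * t + 2 + u - (t + 1) = t + 1 + u by omega,
    show 2 * t + 2 + u - 2 * (t + 1) = u by omega, show 2 * t + 2 + u - t = t + 1 + u + 1 by omega,
    show 2 * t + 2 + u - 2 * t = u + 1 + 1 by omega]
  simp only [Nat.factorial_succ, pow_succ]
  push_cast
  field_simp
  ring

/-- The harmonic polynomial in the invariants with leading term `|0, K⟩`. -/
noncomputable def harmonic (T : Fin 8 → Matrix (Fin 3) (Fin 3) ℂ) (K : ℕ) : Fock :=
  ∑ t ∈ Finset.range (K / 2 + 1), harmonicCoeff K t • brickState T (3 * t) (K - 2 * t)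

theorem harmonic_isHomogeneous (K : ℕ) : (harmonic T K).IsHomogeneous (3 * K) := by
  refine MvPolynomial.IsHomogeneous.sum _ _ _ fun t ht => ?_
  have h : 2 * (3 * t) + 3 * (K - 2 * t) = 3 * K := by
    have := Finset.mem_range.1 ht; omega
  rw [MvPolynomial.smul_eq_C_mul]
  have := (MvPolynomial.isHomogeneous_C (Fin 8) (harmonicCoeff K t)).mul
    (brickState_isHomogeneous (T := T) (3 * t) (K - 2 * t))
  rwa [h, zero_add] at this

theorem laplacian_harmonic (hT : IsSU3Generators T) (K : ℕ) : laplacian (harmonic T K) = 0 := by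
  simp only [harmonic, map_sum, map_smul, laplacian_brickState hT, smul_add,
    Finset.sum_add_distrib]
  -- Aligns the lowering part of term t + 1 with the cubic part of term t. The unmatched ends
  -- vanish: j = 0 at the bottom, and k ∈ {0, 1} at the top.
  rw [Finset.sum_range_succ', Finset.sum_range_succ (n := K / 2)]
  have hlast : (((3 / 4) * ((K - 2 * (K / 2) : ℕ) : ℂ) * (((K - 2 * (K / 2) : ℕ) : ℂ) - 1)) : ℂ)
      = 0 := by
    rcases (show K - 2 * (K / 2) = 0 ∨ K - 2 * (K / 2) = 1 by omega) with h | h <;> rw [h] <;> simp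
  rw [hlast]
  simp only [mul_zero, Nat.cast_zero, zero_mul, zero_smul, smul_zero, add_zero]
  rw [← Finset.sum_add_distrib]
  refine Finset.sum_eq_zero fun t ht => ?_
  have h2 : 2 * t + 2 ≤ K := by have := Finset.mem_range.1 ht; omega
  rw [show 3 * (t + 1) - 1 = 3 * t + 2 by omega, show K - 2 * t - 2 = K - 2 * (t + 1) by omega,
    smul_smul, smul_smul, ← add_smul]
  have h3 := harmonicCoeff_succ h2
  have h4 : ((K - 2 * (t + 1) : ℕ) : ℂ) = K - 2 * (t + 1) := by
    rw [Nat.cast_sub (by omega)]; push_cast; rfl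
  have h5 : ((K - 2 * t : ℕ) : ℂ) = K - 2 * t := by
    rw [Nat.cast_sub (by omega)]; push_cast; rfl
  rw [h4, h5]
  convert zero_smul ℂ _
  push_cast
  linear_combination h3

/-- The state `tr(a†a†)^n` times the harmonic polynomial with leading term `|0, K⟩`. -/
noncomputable def sectorState (T : Fin 8 → Matrix (Fin 3) (Fin 3) ℂ) (n K : ℕ) : Fock :=
  quadInv T ^ n * harmonic T K

theorem sectorState_eq_sum (n K : ℕ) : sectorState T n K =
    ∑ t ∈ Finset.range (K / 2 + 1), harmonicCoeff K t • brickState T (n + 3 * t) (K - 2 * t) := by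
  simp only [sectorState, harmonic, Finset.mul_sum, mul_smul_comm, brickState_eq, pow_add,
    mul_assoc]

theorem sectorState_isHomogeneous (n K : ℕ) :
    (sectorState T n K).IsHomogeneous (2 * n + 3 * K) :=
  (quadInv_isHomogeneous.pow n).mul (harmonic_isHomogeneous K)

theorem sum_Icc_one_eq_sum_range {M : Type*} [AddCommMonoid M] (f : ℕ → M) (κ : ℕ) :
    ∑ t ∈ Finset.Icc 1 κ, f t = ∑ t ∈ Finset.range κ, f (t + 1) := by
  rw [show Finset.Icc 1 κ = Finset.Ico 1 (κ + 1) by ext; simp,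
    Finset.sum_Ico_eq_sum_range]
  simp [add_comm]

/-- Recognizes Γ^even as the harmonic coefficients for K = 2κ, so that both parities can be treated
as one family indexed by K. -/
theorem mixedEven_eq (n κ : ℕ) : mixedEven T n κ = sectorState T n (2 * κ) := by
  rw [sectorState_eq_sum, mixedEven, sum_Icc_one_eq_sum_range, show 2 * κ / 2 + 1 = κ + 1 by omega,
    Finset.sum_range_succ', harmonicCoeff_zero]
  simp only [mul_zero, add_zero, Nat.sub_zero, one_smul]
  refine (add_comm _ _).trans (congrArg₂ (· + ·) (Finset.sum_congr rfl fun t ht => ?_) rfl)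
  have ht' := Finset.mem_range.1 ht
  congr 1
  rw [gammaEven, harmonicCoeff, show κ + (κ - (t + 1)) = 2 * κ - (t + 1) by omega,
    show κ - (κ - (t + 1)) = t + 1 by omega, show 2 * (κ - (t + 1)) = 2 * κ - 2 * (t + 1) by omega,
    show ((κ - (t + 1) : ℕ) : ℤ) - (κ : ℤ) = -((t + 1 : ℕ) : ℤ) by omega, zpow_neg, zpow_natCast]

theorem mixedOdd_eq (n κ : ℕ) : mixedOdd T n κ = sectorState T n (2 * κ + 1) := by
  rw [sectorState_eq_sum, mixedOdd, sum_Icc_one_eq_sum_range,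
    show (2 * κ + 1) / 2 + 1 = κ + 1 by omega,
    Finset.sum_range_succ', harmonicCoeff_zero]
  simp only [mul_zero, add_zero, Nat.sub_zero, one_smul]
  refine (add_comm _ _).trans (congrArg₂ (· + ·) (Finset.sum_congr rfl fun t ht => ?_) rfl)
  have ht' := Finset.mem_range.1 ht
  rw [gammaOdd, harmonicCoeff, show κ + (κ - (t + 1)) + 1 = 2 * κ + 1 - (t + 1) by omega,
    show κ - (κ - (t + 1)) = t + 1 by omega,
    show 2 * (κ - (t + 1)) + 1 = 2 * κ + 1 - 2 * (t + 1) by omega,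
    show 2 * κ - 2 * (t + 1) + 1 = 2 * κ + 1 - 2 * (t + 1) by omega,
    show ((κ - (t + 1) : ℕ) : ℤ) - (κ : ℤ) = -((t + 1 : ℕ) : ℤ) by omega, zpow_neg, zpow_natCast]

/-- Because the harmonic factor is killed by Δ, no other K appears and the action is tridiagonal in
n. -/
theorem hamiltonian_sectorState (hT : IsSU3Generators T) (n K : ℕ) :
    hamiltonian T (sectorState T n K) =
      ((n : ℂ) + 3 / 2 * K + 2) • sectorState T n K - (1 / 2 : ℂ) • sectorState T (n + 1) K -
        ((1 / 2) * n * (n + 3 + 3 * K) : ℂ) • sectorState T (n - 1) K := by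
  rw [hamiltonian_apply hT (sectorState_isHomogeneous n K)]
  have h : laplacian (sectorState T n K) =
      (2 * n * (n + 3 + 3 * K) : ℂ) • sectorState T (n - 1) K := by
    simp only [sectorState]
    rw [laplacian_quadInv_pow_mul hT (harmonic_isHomogeneous K), laplacian_harmonic hT, mul_zero,
      zero_add]
    push_cast
    rfl
  have h2 : quadInv T * sectorState T n K = sectorState T (n + 1) K := by
    simp only [sectorState, pow_succ]; ring
  rw [h, h2]
  push_cast
  module

/-- The recurrence with α = 3K + 3 cancels everything in the interior. Of the two boundary terms,
the one at `m + 1` exceeds the cut-off when `m` is the top index, and the one at `m` carries the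
polynomial whose vanishing quantizes the energy. -/
theorem sum_hamiltonian_sectorState (hT : IsSU3Generators T) (K : ℕ) (E : ℝ) (s : ℕ → ℂ)
    (hs : ∀ n, s n = (((sonine n (3 * K + 3)).eval (2 * E) : ℝ) : ℂ)) (m : ℕ) :
    ∑ n ∈ Finset.range (m + 1), s n • hamiltonian T (sectorState T n K) =
      (E : ℂ) • ∑ n ∈ Finset.range (m + 1), s n • sectorState T n K -
        ((1 / 2) * s m) • sectorState T (m + 1) K +
        ((1 / 2) * (m + 1) * (m + 4 + 3 * K) * s (m + 1)) • sectorState T m K := by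
  induction m with
  | zero =>
    have h := congrArg (fun p => p.eval (2 * E)) (sonine_recurrence_zero (3 * K + 3))
    simp only [Polynomial.eval_mul, Polynomial.eval_C, Polynomial.eval_sub, Polynomial.eval_X] at h
    have h' := congrArg (fun x : ℝ => (x : ℂ)) h
    push_cast at h'
    rw [← hs, ← hs] at h'
    simp only [zero_add, Finset.sum_range_one, hamiltonian_sectorState hT, Nat.cast_zero, mul_zero,
      zero_mul, zero_smul, sub_zero, smul_sub, smul_smul]
    match_scalars
    · linear_combination (-1 / 2) * h'
    · ring
  | succ m ih =>
    have h := congrArg (fun p => p.eval (2 * E)) (sonine_recurrence m (3 * K + 3))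
    simp only [Polynomial.eval_mul, Polynomial.eval_C, Polynomial.eval_sub, Polynomial.eval_X] at h
    have h' := congrArg (fun x : ℝ => (x : ℂ)) h
    push_cast at h'
    rw [← hs, ← hs, ← hs] at h'
    rw [Finset.sum_range_succ, ih, Finset.sum_range_succ _ (m + 1), hamiltonian_sectorState hT,
      Nat.add_sub_cancel]
    generalize ∑ n ∈ Finset.range (m + 1), s n • sectorState T n K = Z
    match_scalars
    · ring
    · linear_combination (-1 / 2) * h'
    · ring
    · ring

/-! ### The eigenstates, sector by sector -/

/-- The number of states of the sector `K` with at most `N` quanta. -/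
def sectorDim (N K : ℕ) : ℕ := (N - 3 * K) / 2 + 1

/-- The energies of the sector `K`. -/
def sectorEnergies (N K : ℕ) : Set ℝ :=
  {E | (sonine (sectorDim N K) (3 * K + 3)).eval (2 * E) = 0}

/-- The eigenstates of the sector `K`, not normalized. -/
noncomputable def sectorSolution (T : Fin 8 → Matrix (Fin 3) (Fin 3) ℂ) (N K : ℕ) (E : ℝ) : Fock :=
  ∑ n ∈ Finset.range (sectorDim N K),
    (((sonine n (3 * K + 3)).eval (2 * E) : ℝ) : ℂ) • sectorState T n K

theorem ncard_sectorEnergies (N K : ℕ) : (sectorEnergies N K).ncard = sectorDim N K :=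
  ncard_sonine_roots _ _

theorem sectorEnergies_pos {N K : ℕ} {E : ℝ} (hE : E ∈ sectorEnergies N K) : 0 < E := by
  by_contra h
  have := sonine_eval_pos (sectorDim N K) (3 * K + 3) (x := 2 * E) (by linarith)
  exact this.ne' hE

theorem sectorState_mem_cutSpace (hT : IsSU3Generators T) {N n K : ℕ} (h : 2 * n + 3 * K ≤ N) :
    sectorState T n K ∈ cutSpace T N := by
  rw [sectorState_eq_sum]
  refine Submodule.sum_mem _ fun t ht => Submodule.smul_mem _ _ (brickState_mem_cutSpace hT ?_)
  have := Finset.mem_range.1 ht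
  omega

theorem sectorSolution_mem_cutSpace (hT : IsSU3Generators T) {N K : ℕ} (hK : 3 * K ≤ N) (E : ℝ) :
    sectorSolution T N K E ∈ cutSpace T N := by
  refine Submodule.sum_mem _ fun n hn => Submodule.smul_mem _ _ (sectorState_mem_cutSpace hT ?_)
  have := Finset.mem_range.1 hn
  rw [sectorDim] at this
  omega

theorem cutHamiltonian_sectorSolution (hT : IsSU3Generators T) {N K : ℕ} (hK : 3 * K ≤ N) {E : ℝ}
    (hE : E ∈ sectorEnergies N K) :
    (cutProjection N * hamiltonian T) (sectorSolution T N K E) =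
      (E : ℂ) • sectorSolution T N K E := by
  have h := sum_hamiltonian_sectorState hT K E _ (fun n => rfl) ((N - 3 * K) / 2)
  have h0 : (sonine ((N - 3 * K) / 2 + 1) (3 * K + 3)).eval (2 * E) = 0 := hE
  rw [h0] at h
  have hP : cutProjection N (sectorSolution T N K E) = sectorSolution T N K E :=
    cutProjection_of_totalDegree_le (mem_cutSpace.1 (sectorSolution_mem_cutSpace hT hK E)).2
  have hP2 : cutProjection N (sectorState T ((N - 3 * K) / 2 + 1) K) = 0 :=
    cutProjection_of_lt (sectorState_isHomogeneous _ _) (by omega)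
  have h1 : hamiltonian T (sectorSolution T N K E) = (E : ℂ) • sectorSolution T N K E -
      ((1 / 2) * (((sonine ((N - 3 * K) / 2) (3 * K + 3)).eval (2 * E) : ℝ) : ℂ)) •
        sectorState T ((N - 3 * K) / 2 + 1) K := by
    rw [sectorSolution, map_sum]
    simp only [map_smul]
    refine h.trans ?_
    simp only [Complex.ofReal_zero, mul_zero, zero_smul, add_zero, sectorDim]
  rw [Module.End.mul_apply, h1, map_sub, map_smul, map_smul, hP, hP2, smul_zero, sub_zero]

theorem inFamily_smul_sectorSolution {N K : ℕ} (hK : 3 * K ≤ N) (E : ℝ) {c : ℂ} (hc : c ≠ 0) :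
    InFamily T N K (c • sectorSolution T N K E) := by
  classical
  set s : ℕ → ℂ := fun n => (((sonine n (3 * K + 3)).eval (2 * E) : ℝ) : ℂ) with hs
  have hs0 : s 0 ≠ 0 := by
    have : ((3 * K + 3).factorial : ℝ)⁻¹ ≠ 0 := by positivity
    simp only [hs, sonine_zero_eq, Polynomial.eval_C]
    exact_mod_cast this
  let I := Finset.range (sectorDim N K) ×ˢ Finset.range (K / 2 + 1)
  have hI : ∀ q ∈ I, q.1 ≤ (N - 3 * K) / 2 ∧ q.2 ≤ K / 2 := by
    intro q hq
    simp only [I, Finset.mem_product, Finset.mem_range, sectorDim] at hq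
    omega
  refine ⟨fun p => ∑ q ∈ I, if p = (q.1 + 3 * q.2, K - 2 * q.2) then
    c * (s q.1 * harmonicCoeff K q.2) else 0, ?_, fun k => ⟨?_, ?_⟩⟩
  · simp only [Finset.sum_smul]
    rw [Finset.sum_comm, sectorSolution, Finset.smul_sum]
    simp only [sectorState_eq_sum, Finset.smul_sum, smul_smul]
    rw [← Finset.sum_product' (f := fun n t => (c * (s n * harmonicCoeff K t)) •
      brickState T (n + 3 * t) (K - 2 * t))]
    refine Finset.sum_congr rfl fun q hq => ?_
    have hmem : (q.1 + 3 * q.2, K - 2 * q.2) ∈ brickIndices N := by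
      rw [mem_brickIndices]
      have := hI q hq
      simp only
      omega
    simp only [ite_smul, zero_smul, Finset.sum_ite_eq', hmem, if_true]
  · rintro ⟨j, _, hj⟩
    obtain ⟨q, hq, hne⟩ := Finset.exists_ne_zero_of_sum_ne_zero hj
    have h1 : (j, k) = (q.1 + 3 * q.2, K - 2 * q.2) := by
      by_contra h; simp [h] at hne
    have h2 := congrArg Prod.snd h1
    simp only at h2
    have := hI q hq
    omega
  · rintro ⟨h1, h2⟩
    obtain ⟨t, rfl⟩ : ∃ t, K = k + 2 * t := ⟨(K - k) / 2, by omega⟩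
    refine ⟨3 * t, ?_, ?_⟩
    · rw [mem_brickIndices]; simp only; omega
    · beta_reduce
      -- The second index determines t, and then j = 3t forces n = 0. Only one product of nonzero
      -- factors contributes, so nothing can cancel.
      rw [Finset.sum_eq_single (0, t)]
      · rw [if_pos (by simp)]
        exact mul_ne_zero hc (mul_ne_zero hs0 (harmonicCoeff_ne_zero _ _))
      · intro q hq hne
        refine if_neg fun h => hne ?_
        have h3 := congrArg Prod.fst h
        have h4 := congrArg Prod.snd h
        simp only at h3 h4
        have := hI q hq
        exact Prod.ext (by simp only; omega) (by simp only; omega)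
      · intro h
        simp only [I, Finset.mem_product, Finset.mem_range, sectorDim] at h
        omega

/-! ### Completeness -/

/-- The change of basis is unitriangular in K and preserves the degree, so it can be inverted by
induction on K. -/
theorem brickState_mem_span_sectorState (n K : ℕ) : brickState T n K ∈
    Submodule.span ℂ {ψ | ∃ m L, 2 * m + 3 * L = 2 * n + 3 * K ∧ ψ = sectorState T m L} := by
  induction K using Nat.strong_induction_on generalizing n with
  | _ K ih =>
    have h := sectorState_eq_sum (T := T) n K
    rw [Finset.sum_range_succ', harmonicCoeff_zero, one_smul] at h
    have h2 : brickState T n K = sectorState T n K - ∑ t ∈ Finset.range (K / 2),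
        harmonicCoeff K (t + 1) • brickState T (n + 3 * (t + 1)) (K - 2 * (t + 1)) := by
      rw [h]; simp
    rw [h2]
    refine Submodule.sub_mem _ (Submodule.subset_span ⟨n, K, rfl, rfl⟩)
      (Submodule.sum_mem _ fun t ht => Submodule.smul_mem _ _ ?_)
    have ht' := Finset.mem_range.1 ht
    have h3 := ih (K - 2 * (t + 1)) (by omega) (n + 3 * (t + 1))
    rwa [show 2 * (n + 3 * (t + 1)) + 3 * (K - 2 * (t + 1)) = 2 * n + 3 * K by omega] at h3

/-- Labels of a basis of the cut space adapted to the sectors. -/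
abbrev SectorIndex (N : ℕ) : Type := Σ K : Fin (N / 3 + 1), Fin (sectorDim N K)

theorem sectorIndex_le {N : ℕ} (q : SectorIndex N) : 2 * (q.2 : ℕ) + 3 * (q.1 : ℕ) ≤ N := by
  have h1 := q.1.2
  have h2 : (q.2 : ℕ) < (N - 3 * q.1) / 2 + 1 := q.2.2
  omega

theorem exists_sectorIndex {N n K : ℕ} (h : 2 * n + 3 * K ≤ N) :
    ∃ q : SectorIndex N, (q.2 : ℕ) = n ∧ (q.1 : ℕ) = K :=
  ⟨⟨⟨K, by omega⟩, ⟨n, by simp only [sectorDim]; omega⟩⟩, rfl, rfl⟩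

theorem finrank_cutSpace (hT : IsSU3Generators T) (N : ℕ) :
    Module.finrank ℂ (cutSpace T N) = Fintype.card (SectorIndex N) := by
  have hinj : Function.Injective fun q : SectorIndex N => ((q.2 : ℕ), (q.1 : ℕ)) := by
    rintro ⟨⟨K, hK⟩, ⟨n, hn⟩⟩ ⟨⟨L, hL⟩, ⟨m, hm⟩⟩ h
    simp only [Prod.mk.injEq] at h
    obtain ⟨rfl, rfl⟩ := h
    rfl
  have hli := (linearIndependent_brickState hT).comp _ hinj
  have hrange : (Set.range fun p : brickIndices N => brickState T p.1.1 p.1.2) =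
      Set.range ((fun p : ℕ × ℕ => brickState T p.1 p.2) ∘
        fun q : SectorIndex N => ((q.2 : ℕ), (q.1 : ℕ))) := by
    ext ψ
    constructor
    · rintro ⟨p, rfl⟩
      obtain ⟨q, h1, h2⟩ := exists_sectorIndex (mem_brickIndices.1 p.2)
      exact ⟨q, by simp [h1, h2]⟩
    · rintro ⟨q, rfl⟩
      exact ⟨⟨_, mem_brickIndices.2 (sectorIndex_le q)⟩, rfl⟩
  rw [← finrank_span_eq_card hli, ← span_brickState hT, hrange]

theorem finiteDimensional_cutSpace (hT : IsSU3Generators T) (N : ℕ) :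
    FiniteDimensional ℂ (cutSpace T N) := by
  rw [← span_brickState hT]
  exact FiniteDimensional.span_of_finite ℂ (Set.finite_range _)

/-- A spanning family with as many members as the dimension is independent. -/
theorem linearIndependent_sectorState (hT : IsSU3Generators T) (N : ℕ) :
    LinearIndependent ℂ fun q : SectorIndex N => sectorState T (q.2 : ℕ) (q.1 : ℕ) := by
  have hspan : cutSpace T N = Submodule.span ℂ
      (Set.range fun q : SectorIndex N => sectorState T (q.2 : ℕ) (q.1 : ℕ)) := by
    apply le_antisymm
    · rw [← span_brickState hT, Submodule.span_le]
      rintro _ ⟨p, rfl⟩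
      refine Submodule.span_mono ?_ (brickState_mem_span_sectorState p.1.1 p.1.2)
      rintro _ ⟨m, L, h, rfl⟩
      have hp := mem_brickIndices.1 p.2
      obtain ⟨q, h1, h2⟩ := exists_sectorIndex (N := N) (n := m) (K := L) (by omega)
      exact ⟨q, by simp [h1, h2]⟩
    · rw [Submodule.span_le]
      rintro _ ⟨q, rfl⟩
      exact sectorState_mem_cutSpace hT (sectorIndex_le q)
  rw [linearIndependent_iff_card_eq_finrank_span, Set.finrank, ← finrank_cutSpace hT, ← hspan]

theorem linearIndependent_sigma {ι V : Type*} [Fintype ι] [AddCommGroup V] [Module ℂ V]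
    {α β : ι → Type*} [∀ i, Fintype (α i)] [∀ i, Fintype (β i)] {S : (Σ i, β i) → V}
    (hS : LinearIndependent ℂ S) {m : ∀ i, α i → β i → ℂ}
    (hm : ∀ i, LinearIndependent ℂ (m i)) :
    LinearIndependent ℂ fun p : Σ i, α i => ∑ b, m p.1 p.2 b • S ⟨p.1, b⟩ := by
  rw [Fintype.linearIndependent_iff] at hS ⊢
  intro g hg
  have h1 : ∑ q : Σ i, β i, (∑ a, g ⟨q.1, a⟩ * m q.1 a q.2) • S q = 0 := by
    rw [← hg, Fintype.sum_sigma, Fintype.sum_sigma]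
    refine Finset.sum_congr rfl fun i _ => ?_
    simp only [Finset.sum_smul, Finset.smul_sum, smul_smul]
    exact Finset.sum_comm (s := Finset.univ) (t := Finset.univ)
      (f := fun (b : β i) (a : α i) => (g ⟨i, a⟩ * m i a b) • S ⟨i, b⟩)
  have h2 := hS _ h1
  rintro ⟨i, a⟩
  have h3 := Fintype.linearIndependent_iff.1 (hm i) (fun a => g ⟨i, a⟩) ?_ a
  · exact h3
  · funext b
    simpa using h2 ⟨i, b⟩

theorem sectorSolution_eq_sum_fin (N K : ℕ) (E : ℝ) : sectorSolution T N K E =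
    ∑ n : Fin (sectorDim N K),
      (((sonine n (3 * K + 3)).eval (2 * E) : ℝ) : ℂ) • sectorState T n K := by
  rw [sectorSolution, Finset.sum_range]

theorem sectorSolution_ne_zero (hT : IsSU3Generators T) {N K : ℕ} (hK : 3 * K ≤ N) (E : ℝ) :
    sectorSolution T N K E ≠ 0 := by
  intro h
  have hli := (linearIndependent_sectorState hT N).comp
    (Sigma.mk (⟨K, by omega⟩ : Fin (N / 3 + 1))) sigma_mk_injective
  rw [sectorSolution_eq_sum_fin] at h
  have h2 := Fintype.linearIndependent_iff.1 hli _ h ⟨0, Nat.succ_pos _⟩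
  rw [sonine_zero_eq, Polynomial.eval_C] at h2
  have h3 : ((3 * K + 3).factorial : ℝ)⁻¹ ≠ 0 := by positivity
  exact h3 (by exact_mod_cast h2)

/-- Labels of the eigenstates, sector by sector. -/
abbrev SolutionIndex (N : ℕ) : Type := Σ K : Fin (N / 3 + 1), sectorEnergies N K

theorem finite_sectorEnergies (N K : ℕ) : (sectorEnergies N K).Finite :=
  -- Infinite sets have `ncard` zero, so a positive count already gives finiteness.
  Set.finite_of_ncard_pos (by rw [ncard_sectorEnergies]; exact Nat.succ_pos _)

noncomputable instance (N K : ℕ) : Fintype (sectorEnergies N K) :=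
  (finite_sectorEnergies N K).fintype

theorem card_solutionIndex (N : ℕ) :
    Fintype.card (SolutionIndex N) = Fintype.card (SectorIndex N) := by
  rw [Fintype.card_sigma, Fintype.card_sigma]
  refine Finset.sum_congr rfl fun K _ => ?_
  rw [Fintype.card_fin, ← ncard_sectorEnergies, ← Nat.card_coe_set_eq, Nat.card_eq_fintype_card]

theorem linearIndependent_sectorSolution (hT : IsSU3Generators T) (N : ℕ) :
    LinearIndependent ℂ fun p : SolutionIndex N => sectorSolution T N p.1 (p.2 : ℝ) := by
  have h := linearIndependent_sigma (linearIndependent_sectorState hT N)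
    (α := fun K : Fin (N / 3 + 1) => sectorEnergies N K)
    (m := fun K E n => (((sonine n (3 * K + 3)).eval (2 * (E : ℝ)) : ℝ) : ℂ)) ?_
  · simpa only [← sectorSolution_eq_sum_fin] using h
  · intro K
    have hK : 3 * (K : ℕ) ≤ N := by have := K.2; omega
    -- Within one sector the coefficient vectors map to eigenvectors with distinct eigenvalues.
    -- Across sectors energies might coincide, so independence there comes from the block structure
    -- instead.
    refine LinearIndependent.of_comp
      (Fintype.linearCombination ℂ fun n : Fin (sectorDim N K) => sectorState T n K) ?_
    refine Module.End.eigenvectors_linearIndependent' (cutProjection N * hamiltonian T)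
      (fun E : sectorEnergies N K => ((E : ℝ) : ℂ)) ?_ _ ?_
    · intro E F hEF
      exact Subtype.ext (Complex.ofReal_injective hEF)
    · intro E
      have h1 : (Fintype.linearCombination ℂ fun n : Fin (sectorDim N K) => sectorState T n K)
          (fun n => (((sonine n (3 * K + 3)).eval (2 * (E : ℝ)) : ℝ) : ℂ)) =
          sectorSolution T N K E := by
        rw [sectorSolution_eq_sum_fin, Fintype.linearCombination_apply]
      rw [Function.comp_apply, h1]
      exact Module.End.hasEigenvector_iff.2 ⟨Module.End.mem_eigenspace_iff.2
        (cutHamiltonian_sectorSolution hT hK E.2), sectorSolution_ne_zero hT hK E⟩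

/-- A basis of eigenvectors determines all eigenspaces. -/
theorem eigenspace_inf_span_eq {ι V : Type*} [Finite ι] [AddCommGroup V] [Module ℂ V]
    (f : Module.End ℂ V) {v : ι → V} (hv : LinearIndependent ℂ v) {e : ι → ℂ}
    (he : ∀ i, f (v i) = e i • v i) (E : ℂ) :
    Submodule.span ℂ (Set.range v) ⊓ LinearMap.ker (f - E • (1 : Module.End ℂ V)) =
      Submodule.span ℂ (v '' {i | e i = E}) := by
  have := Fintype.ofFinite ι
  apply le_antisymm
  · rintro x ⟨hx, hxE⟩
    obtain ⟨c, rfl⟩ := (Submodule.mem_span_range_iff_exists_fun ℂ).1 hx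
    have h1 : ∑ i, (c i * (e i - E)) • v i = 0 := by
      rw [SetLike.mem_coe, LinearMap.mem_ker, map_sum] at hxE
      rw [← hxE]
      refine Finset.sum_congr rfl fun i _ => ?_
      simp only [LinearMap.sub_apply, map_smul, he, LinearMap.smul_apply, Module.End.one_apply]
      module
    have h2 := Fintype.linearIndependent_iff.1 hv _ h1
    refine Submodule.sum_mem _ fun i _ => ?_
    rcases mul_eq_zero.1 (h2 i) with h | h
    · simp [h]
    · exact Submodule.smul_mem _ _ (Submodule.subset_span ⟨i, sub_eq_zero.1 h, rfl⟩)
  · rw [Submodule.span_le]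
    rintro _ ⟨i, hi, rfl⟩
    refine ⟨Submodule.subset_span ⟨i, rfl⟩, ?_⟩
    rw [SetLike.mem_coe, LinearMap.mem_ker]
    simp only [LinearMap.sub_apply, he, LinearMap.smul_apply, Module.End.one_apply]
    rw [show e i = E from hi, sub_self]

end Sectors

end SU3Fock

namespace SU3Fock

section Assembly

variable {T : Fin 8 → Matrix (Fin 3) (Fin 3) ℂ}

/-! ### The even and the odd families -/

theorem evenEnergies_eq (N κ : ℕ) : evenEnergies N κ = sectorEnergies N (2 * κ) := by
  rw [evenEnergies, sectorEnergies, dEven, sectorDim, show 3 * (2 * κ) = 6 * κ by ring]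

theorem oddEnergies_eq (N κ : ℕ) : oddEnergies N κ = sectorEnergies N (2 * κ + 1) := by
  rw [oddEnergies, sectorEnergies, dOdd, sectorDim, show 3 * (2 * κ + 1) = 6 * κ + 3 by ring,
    Nat.sub_sub]

theorem dEven_eq (N κ : ℕ) : dEven N κ = sectorDim N (2 * κ) := by
  rw [dEven, sectorDim, show 3 * (2 * κ) = 6 * κ by ring]

theorem dOdd_eq (N κ : ℕ) : dOdd N κ = sectorDim N (2 * κ + 1) := by
  rw [dOdd, sectorDim, show 3 * (2 * κ + 1) = 6 * κ + 3 by ring, Nat.sub_sub]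

theorem evenState_eq (N κ : ℕ) (E : ℝ) : evenState T N κ E =
    (((2 * E) ^ (3 * κ) * Real.exp (-E) : ℝ) : ℂ) • sectorSolution T N (2 * κ) E := by
  simp only [evenState, sectorSolution, mixedEven_eq, dEven_eq,
    show 3 * (2 * κ) + 3 = 6 * κ + 3 by ring]

theorem oddState_eq (N κ : ℕ) (E : ℝ) : oddState T N κ E =
    (((2 * E) ^ (3 * (κ : ℝ) + 3 / 2) * Real.exp (-E) : ℝ) : ℂ) •
      sectorSolution T N (2 * κ + 1) E := by
  simp only [oddState, sectorSolution, mixedOdd_eq, dOdd_eq,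
    show 3 * (2 * κ + 1) + 3 = 6 * κ + 6 by ring]

theorem evenFactor_ne_zero (κ : ℕ) {E : ℝ} (hE : 0 < E) :
    (((2 * E) ^ (3 * κ) * Real.exp (-E) : ℝ) : ℂ) ≠ 0 :=
  Complex.ofReal_ne_zero.2 (by positivity)

theorem oddFactor_ne_zero (κ : ℕ) {E : ℝ} (hE : 0 < E) :
    (((2 * E) ^ (3 * (κ : ℝ) + 3 / 2) * Real.exp (-E) : ℝ) : ℂ) ≠ 0 :=
  Complex.ofReal_ne_zero.2 (by positivity)

theorem mem_cutEigenspace {N : ℕ} {E : ℂ} {ψ : Fock} : ψ ∈ cutEigenspace T N E ↔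
    ψ ∈ cutSpace T N ∧ (cutProjection N * hamiltonian T) ψ = E • ψ := by
  simp [cutEigenspace, sub_eq_zero]

theorem smul_sectorSolution_properties (hT : IsSU3Generators T) {N K : ℕ} (hK : 3 * K ≤ N) {E : ℝ}
    (hE : E ∈ sectorEnergies N K) {c : ℂ} (hc : c ≠ 0) :
    c • sectorSolution T N K E ≠ 0 ∧ c • sectorSolution T N K E ∈ cutEigenspace T N (E : ℂ) ∧
      InFamily T N K (c • sectorSolution T N K E) := by
  refine ⟨smul_ne_zero hc (sectorSolution_ne_zero hT hK E), Submodule.smul_mem _ _ ?_,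
    inFamily_smul_sectorSolution hK E hc⟩
  exact mem_cutEigenspace.2
    ⟨sectorSolution_mem_cutSpace hT hK E, cutHamiltonian_sectorSolution hT hK hE⟩

theorem evenState_properties (hT : IsSU3Generators T) {N κ : ℕ} (hκ : 6 * κ ≤ N) {E : ℝ}
    (hE : E ∈ evenEnergies N κ) : 0 < E ∧ evenState T N κ E ≠ 0 ∧
      evenState T N κ E ∈ cutEigenspace T N (E : ℂ) ∧
      InFamily T N (2 * κ) (evenState T N κ E) := by
  rw [evenEnergies_eq] at hE
  have hpos := sectorEnergies_pos hE
  rw [evenState_eq]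
  exact ⟨hpos, smul_sectorSolution_properties hT (by omega) hE (evenFactor_ne_zero κ hpos)⟩

theorem oddState_properties (hT : IsSU3Generators T) {N κ : ℕ} (hκ : 6 * κ + 3 ≤ N) {E : ℝ}
    (hE : E ∈ oddEnergies N κ) : 0 < E ∧ oddState T N κ E ≠ 0 ∧
      oddState T N κ E ∈ cutEigenspace T N (E : ℂ) ∧
      InFamily T N (2 * κ + 1) (oddState T N κ E) := by
  rw [oddEnergies_eq] at hE
  have hpos := sectorEnergies_pos hE
  rw [oddState_eq]
  exact ⟨hpos, smul_sectorSolution_properties hT (by omega) hE (oddFactor_ne_zero κ hpos)⟩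

/-- The even and odd labels together are the labels of all sectors. -/
def toSolutionIndex (N : ℕ) : EvenLabel N ⊕ OddLabel N → SolutionIndex N :=
  Sum.elim
    (fun p => ⟨⟨2 * p.1.1, by have := p.2.1; omega⟩, ⟨p.1.2, evenEnergies_eq N _ ▸ p.2.2⟩⟩)
    (fun p => ⟨⟨2 * p.1.1 + 1, by have := p.2.1; omega⟩, ⟨p.1.2, oddEnergies_eq N _ ▸ p.2.2⟩⟩)

theorem energy_toSolutionIndex (N : ℕ) (s : EvenLabel N ⊕ OddLabel N) :
    energy N s = ((toSolutionIndex N s).2 : ℝ) := by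
  rcases s with p | p <;> rfl

theorem toSolutionIndex_injective (N : ℕ) : Function.Injective (toSolutionIndex N) := by
  have h : ∀ s t, toSolutionIndex N s = toSolutionIndex N t →
      ((toSolutionIndex N s).1 : ℕ) = (toSolutionIndex N t).1 ∧
        ((toSolutionIndex N s).2 : ℝ) = (toSolutionIndex N t).2 := by
    intro s t hst
    rw [hst]
    exact ⟨rfl, rfl⟩
  rintro (⟨⟨κ, E⟩, hp⟩ | ⟨⟨κ, E⟩, hp⟩) (⟨⟨μ, F⟩, hq⟩ | ⟨⟨μ, F⟩, hq⟩) hst <;>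
    obtain ⟨h1, h2⟩ := h _ _ hst
  · change 2 * κ = 2 * μ at h1
    change E = F at h2
    obtain rfl : κ = μ := by omega
    subst h2; rfl
  · change 2 * κ = 2 * μ + 1 at h1
    omega
  · change 2 * κ + 1 = 2 * μ at h1
    omega
  · change 2 * κ + 1 = 2 * μ + 1 at h1
    change E = F at h2
    obtain rfl : κ = μ := by omega
    subst h2; rfl

theorem toSolutionIndex_surjective (N : ℕ) : Function.Surjective (toSolutionIndex N) := by
  rintro ⟨⟨K, hK⟩, ⟨E, hE⟩⟩
  rcases Nat.even_or_odd' K with ⟨κ, rfl | rfl⟩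
  · exact ⟨Sum.inl ⟨(κ, E), by simp only; omega, (evenEnergies_eq N κ).symm ▸ hE⟩, rfl⟩
  · exact ⟨Sum.inr ⟨(κ, E), by simp only; omega, (oddEnergies_eq N κ).symm ▸ hE⟩, rfl⟩

/-- The prefactors are invertible because the energies are positive, so they affect neither
independence nor span. -/
theorem solution_eq (N : ℕ) (s : EvenLabel N ⊕ OddLabel N) : ∃ c : ℂˣ, solution T N s =
    c • sectorSolution T N (toSolutionIndex N s).1 ((toSolutionIndex N s).2 : ℝ) := by
  have hpos := sectorEnergies_pos (toSolutionIndex N s).2.2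
  rcases s with p | p
  · exact ⟨Units.mk0 _ (evenFactor_ne_zero p.1.1 hpos), evenState_eq N _ _⟩
  · exact ⟨Units.mk0 _ (oddFactor_ne_zero p.1.1 hpos), oddState_eq N _ _⟩

theorem linearIndependent_solution (hT : IsSU3Generators T) (N : ℕ) :
    LinearIndependent ℂ (solution T N) := by
  choose c hc using solution_eq (T := T) N
  have h := ((linearIndependent_sectorSolution hT N).comp _
    (toSolutionIndex_injective N)).units_smul c
  have heq : solution T N = c • ((fun p : SolutionIndex N => sectorSolution T N p.1 (p.2 : ℝ)) ∘
      toSolutionIndex N) := funext hc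
  rw [heq]
  exact h

theorem solution_mem (hT : IsSU3Generators T) (N : ℕ) (s : EvenLabel N ⊕ OddLabel N) :
    solution T N s ∈ cutEigenspace T N (energy N s : ℂ) := by
  rcases s with p | p
  · exact (evenState_properties hT p.2.1 p.2.2).2.2.1
  · exact (oddState_properties hT p.2.1 p.2.2).2.2.1

theorem span_solution (hT : IsSU3Generators T) (N : ℕ) :
    Submodule.span ℂ (Set.range (solution T N)) = cutSpace T N := by
  have := finiteDimensional_cutSpace hT N
  have := Fintype.ofInjective _ (toSolutionIndex_injective N)
  refine Submodule.eq_of_le_of_finrank_eq ?_ ?_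
  · rw [Submodule.span_le]
    rintro _ ⟨s, rfl⟩
    exact (mem_cutEigenspace.1 (solution_mem hT N s)).1
  · rw [finrank_span_eq_card (linearIndependent_solution hT N), finrank_cutSpace hT,
      ← card_solutionIndex]
    exact Fintype.card_of_bijective ⟨toSolutionIndex_injective N, toSolutionIndex_surjective N⟩

theorem cutEigenspace_eq (hT : IsSU3Generators T) (N : ℕ) (E : ℂ) : cutEigenspace T N E =
    Submodule.span ℂ (solution T N '' {s | (energy N s : ℂ) = E}) := by
  have := Finite.of_injective _ (toSolutionIndex_injective N)
  rw [cutEigenspace, ← span_solution hT]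
  exact eigenspace_inf_span_eq _ (linearIndependent_solution hT N)
    (fun s => (mem_cutEigenspace.1 (solution_mem hT N s)).2) E

/-! ### The product Θ and the spectrum -/

theorem prod_range_eq_even_mul_odd {M : Type*} [CommMonoid M] (f : ℕ → M) (N : ℕ) :
    ∏ k ∈ Finset.range (N / 3 + 1), f k =
      (∏ κ ∈ (Finset.range (N + 1)).filter (fun κ => 6 * κ ≤ N), f (2 * κ)) *
      ∏ κ ∈ (Finset.range (N + 1)).filter (fun κ => 6 * κ + 3 ≤ N), f (2 * κ + 1) := by
  rw [← Finset.prod_filter_mul_prod_filter_not (Finset.range (N / 3 + 1)) (fun k => k % 2 = 0)]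
  congr 1
  · refine Finset.prod_nbij' (fun k => k / 2) (fun κ => 2 * κ) ?_ ?_ ?_ ?_ ?_ <;>
      simp only [Finset.mem_filter, Finset.mem_range]
    · intro k hk; omega
    · intro k hk; omega
    · intro k hk; omega
    · intro k hk; omega
    · intro k hk; rw [show 2 * (k / 2) = k by omega]
  · refine Finset.prod_nbij' (fun k => k / 2) (fun κ => 2 * κ + 1) ?_ ?_ ?_ ?_ ?_ <;>
      simp only [Finset.mem_filter, Finset.mem_range]
    · intro k hk; omega
    · intro k hk; omega
    · intro k hk; omega
    · intro k hk; omega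
    · intro k hk; rw [show 2 * (k / 2) + 1 = k by omega]

theorem thetaPoly_eval (N : ℕ) (E : ℝ) : (thetaPoly N).eval E =
    (∏ κ ∈ (Finset.range (N + 1)).filter (fun κ => 6 * κ ≤ N),
      (sonine (dEven N κ) (6 * κ + 3)).eval (2 * E)) *
    ∏ κ ∈ (Finset.range (N + 1)).filter (fun κ => 6 * κ + 3 ≤ N),
      (sonine (dOdd N κ) (6 * κ + 6)).eval (2 * E) := by
  rw [thetaPoly, Polynomial.eval_prod]
  simp only [Polynomial.eval_comp, Polynomial.eval_mul, Polynomial.eval_C, Polynomial.eval_X]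
  rw [prod_range_eq_even_mul_odd]
  simp only [dEven_eq, dOdd_eq, sectorDim, show ∀ κ, 3 * (2 * κ) + 3 = 6 * κ + 3 by intro; ring,
    show ∀ κ, 3 * (2 * κ + 1) + 3 = 6 * κ + 6 by intro; ring]

/-- A zero of the product is a zero of some factor, and since each factor has only real roots, even
a complex zero is the energy of a label. -/
theorem aeval_thetaPoly_eq_zero_iff (N : ℕ) (E : ℂ) : Polynomial.aeval E (thetaPoly N) = 0 ↔
    ∃ p : SolutionIndex N, ((p.2 : ℝ) : ℂ) = E := by
  rw [thetaPoly, map_prod, Finset.prod_eq_zero_iff]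
  simp only [Polynomial.aeval_comp, map_mul, Polynomial.aeval_C, Polynomial.aeval_X,
    Finset.mem_range]
  have h2 : (algebraMap ℝ ℂ) 2 = 2 := by simp
  simp only [h2]
  constructor
  · rintro ⟨K, hK, h⟩
    have hr := sonine_root_real h
    rw [← hr, aeval_ofReal, Complex.ofReal_eq_zero] at h
    have hre : (2 * E).re = 2 * E.re := by simp
    have hE : (E.re : ℂ) = E := by
      rw [hre] at hr
      push_cast at hr
      exact mul_left_cancel₀ two_ne_zero hr
    rw [hre] at h
    exact ⟨⟨⟨K, hK⟩, ⟨E.re, h⟩⟩, hE⟩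
  · rintro ⟨⟨⟨K, hK⟩, ⟨E', hE'⟩⟩, rfl⟩
    refine ⟨K, hK, ?_⟩
    have h3 : (2 : ℂ) * (E' : ℂ) = ((2 * E' : ℝ) : ℂ) := by push_cast; rfl
    rw [h3, aeval_ofReal]
    exact congrArg _ hE'

theorem exists_solution_iff (hT : IsSU3Generators T) (N : ℕ) (E : ℂ) :
    (∃ ψ ∈ cutEigenspace T N E, ψ ≠ 0) ↔ Polynomial.aeval E (thetaPoly N) = 0 := by
  rw [aeval_thetaPoly_eq_zero_iff]
  constructor
  · rintro ⟨ψ, hψ, h0⟩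
    by_contra! h
    have hempty : {s : EvenLabel N ⊕ OddLabel N | (energy N s : ℂ) = E} = ∅ := by
      ext s
      simp only [Set.mem_ofPred_eq, Set.mem_empty_iff_false, iff_false]
      rw [energy_toSolutionIndex]
      exact h _
    rw [cutEigenspace_eq hT, hempty, Set.image_empty, Submodule.span_empty, Submodule.mem_bot] at hψ
    exact h0 hψ
  · rintro ⟨p, rfl⟩
    obtain ⟨s, rfl⟩ := toSolutionIndex_surjective N p
    refine ⟨solution T N s, ?_, (linearIndependent_solution hT N).ne_zero s⟩
    rw [← energy_toSolutionIndex]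
    exact solution_mem hT N s

end Assembly

end SU3Fock

theorem mainTheorem1 (T : Fin 8 → Matrix (Fin 3) (Fin 3) ℂ) (hT : IsSU3Generators T) (N : ℕ) :
    -- the states `|j, k⟩` with `2j + 3k ≤ N` form a basis of the cut bosonic sector
    (LinearIndependent ℂ (fun p : brickIndices N => brickState T p.1.1 p.1.2) ∧
      Submodule.span ℂ (Set.range fun p : brickIndices N => brickState T p.1.1 p.1.2)
        = cutSpace T N) ∧
    -- the family `f_κ`: `d_κ` positive energies, each with its eigenstate
    (∀ κ : ℕ, 6 * κ ≤ N →
      (evenEnergies N κ).ncard = dEven N κ ∧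
      ∀ E ∈ evenEnergies N κ, 0 < E ∧ evenState T N κ E ≠ 0 ∧
        evenState T N κ E ∈ cutEigenspace T N (E : ℂ) ∧
        InFamily T N (2 * κ) (evenState T N κ E)) ∧
    -- the family `g_κ`: `d'_κ` positive energies, each with its eigenstate
    (∀ κ : ℕ, 6 * κ + 3 ≤ N →
      (oddEnergies N κ).ncard = dOdd N κ ∧
      ∀ E ∈ oddEnergies N κ, 0 < E ∧ oddState T N κ E ≠ 0 ∧
        oddState T N κ E ∈ cutEigenspace T N (E : ℂ) ∧
        InFamily T N (2 * κ + 1) (oddState T N κ E)) ∧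
    -- these eigenstates form a basis of the cut bosonic sector
    (LinearIndependent ℂ (solution T N) ∧
      Submodule.span ℂ (Set.range (solution T N)) = cutSpace T N) ∧
    -- there are no other solutions of the eigenvalue problem
    (∀ E : ℂ, cutEigenspace T N E =
      Submodule.span ℂ (solution T N '' {s | (energy N s : ℂ) = E})) ∧
    -- `Θ` is the product of all the quantization conditions
    (∀ E : ℝ, (thetaPoly N).eval E =
      (∏ κ ∈ (Finset.range (N + 1)).filter (fun κ => 6 * κ ≤ N),
        (sonine (dEven N κ) (6 * κ + 3)).eval (2 * E)) *
      ∏ κ ∈ (Finset.range (N + 1)).filter (fun κ => 6 * κ + 3 ≤ N),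
        (sonine (dOdd N κ) (6 * κ + 6)).eval (2 * E)) ∧
    -- the spectrum is the set of the roots of `Θ`
    (∀ E : ℂ, (∃ ψ ∈ cutEigenspace T N E, ψ ≠ 0) ↔ Polynomial.aeval E (thetaPoly N) = 0) := by

  refine ⟨⟨?_, SU3Fock.span_brickState hT N⟩, fun κ hκ => ⟨?_, fun E hE => ?_⟩,
    fun κ hκ => ⟨?_, fun E hE => ?_⟩,
    ⟨SU3Fock.linearIndependent_solution hT N, SU3Fock.span_solution hT N⟩,
    SU3Fock.cutEigenspace_eq hT N, SU3Fock.thetaPoly_eval N, SU3Fock.exists_solution_iff hT N⟩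
  · exact (SU3Fock.linearIndependent_brickState hT).comp _ Subtype.val_injective
  · rw [SU3Fock.evenEnergies_eq, SU3Fock.dEven_eq, SU3Fock.ncard_sectorEnergies]
  · exact SU3Fock.evenState_properties hT hκ hE
  · rw [SU3Fock.oddEnergies_eq, SU3Fock.dOdd_eq, SU3Fock.ncard_sectorEnergies]
  · exact SU3Fock.oddState_properties hT hκ hE
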